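/- Fix $M\ge 2$ and priorities $\mathbb P=\{0,\dots,M\}$. **Diagrams.** Let $\mathsf{Syn}_M$ be the free prop (strict symmetric monoidal category) on two generating objects $\blacktriangleright,\blacktriangleleft$ and the generating morphisms $$\vee:\blacktriangleright\to\blacktriangleright\blacktriangleright,\quad \bot:\blacktriangleright\to\varepsilon,\quad \wedge:\blacktriangleright\to\blacktriangleright\blacktriangleright,\quad \top:\blacktriangleright\to\varepsilon,\quad \mu:\blacktriangleright\blacktriangleright\to\blacktriangleright,\quad \eta:\varepsilon\to\blacktriangleright,\quad \langle p\rangle:\blacktriangleright\to\blacktriangleright\ (p\in\mathbb P),$$ together with $\mathrm{cap}:\blacktriangleleft\blacktriangleright\to\varepsilon$ and $\mathrm{cup}:\varepsilon\to\blacktriangleright\blacktriangleleft$. (Here $\vee,\bot$ are Player 0 nodes with two, resp. no exits, and $\wedge,\top$ the same for Player 1.) A diagram is a morphism of $\mathsf{Syn}_M$; it is *acyclic* if it is composed without $\mathrm{cap}$ and $\mathrm{cup}$. A diagram is in *normal form* if it equals $d_0;d_1;d_2;d_3$, where, besides identities and wire crossings, $d_0$ uses only $\vee,\bot$, $d_1$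 only $\wedge,\top$, $d_2$ only the $\langle p\rangle$, and $d_3$ only $\mu,\eta$. **Semantics.** An open parity game $A:v\to w$ has entries (the letters $\blacktriangleright$ of $v$ and $\blacktriangleleft$ of $w$), exits (the letters $\blacktriangleleft$ of $v$ and $\blacktriangleright$ of $w$), a finite set $V$ of internal positions, $V_0\subseteq V$ (Player 0's positions; the rest are Player 1's), a labelling $V\to\mathbb P$, and a set of edges from entries and internal positions to internal positions and exits, with exactly one edge out of each entry and exactly one into each exit. A diagram $d:v\to w$ is interpreted as a game $[\![d]\!]:v\to w$: identities, crossings, cap and cup are wires without internal positions; every other generator is a single position to which all entries lead and which leads to all exits, owned by Player 0 for $\vee,\bot$ and by Player 1 otherwise, with priority $p$ for $\langle p\rangle$ and $0$ otherwise; the monoidal product is juxtaposition; composition hides the middle wires and makes each path through them an edge. Strategies may depend on the history of the play. A play that stops at an internal position is lost by its owner; an infinite play is won by Player 0 iff the greatest priority occurring infinitely often is even; a play that ends at an exit $o$ has outcome $(o,k)$, with $k$ the greatest priority seen ($0$ if there is none). The semantics of $A$ is the set of pairs $(T,i)$, with $i$ an entry and $T$ a set of pairs (exit, priority), such that Player 0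 has a strategy from $i$ for which every Player 1 strategy gives a play that is won by Player 0 or has its outcome in $T$. Write $A\simeq B$ if $A,B:v\to w$ have the same semantics. **Equations.** Let $=_{\mathrm{PGA}}$ be the smallest congruence on diagrams, for both compositions, such that (writing $1$ for the identity of $\blacktriangleright$ and $\sigma$ for the crossing of two $\blacktriangleright$-wires): - A: cap and cup satisfy the two yanking equations, and the closed loop is the empty diagram; - B: $(\mu,\eta)$ is a commutative monoid; $(\vee,\bot)$ and $(\wedge,\top)$ are cocommutative comonoids; for $(\delta,\epsilon)\in\{(\vee,\bot),(\wedge,\top)\}$: $\mu;\delta=(\delta\otimes\delta);(1\otimes\sigma\otimes1);(\mu\otimes\mu)$, $\mu;\epsilon=\epsilon\otimes\epsilon$, $\eta;\delta=\eta\otimes\eta$, $\eta;\epsilon=\mathrm{id}_\varepsilon$, $\delta;\mu=1$; and for $(\delta,\delta',\epsilon')\in\{(\vee,\wedge,\top),(\wedge,\vee,\bot)\}$: $\delta;(\delta'\otimes1)=\delta';(\delta\otimes\delta);(1\otimes\sigma\otimes1);(1\otimes1\otimes\mu)$ and $\delta;(\epsilon'\otimes1)=\epsilon';\eta$; - C: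 $(\langle k\rangle\otimes\langle k\rangle);\mu=\mu;\langle k\rangle$, $\eta;\langle k\rangle=\eta$, $\langle k\rangle;\langle l\rangle=\langle\max(k,l)\rangle$, $\langle0\rangle=1$; - D: $\langle k\rangle;\delta=\delta;(\langle k\rangle\otimes\langle k\rangle)$ and $\langle k\rangle;\epsilon=\epsilon$ for $(\delta,\epsilon)\in\{(\vee,\bot),(\wedge,\top)\}$; - E: the trace over the first wire (formed with cup and cap) of $\mu;\vee;(\wedge\otimes1);(\langle p\rangle\otimes1\otimes1)$ equals $\vee$ if $p$ is even and $\eta\otimes1$ if $p$ is odd. **Theorem.** Let $c,d:\blacktriangleright^m\to\blacktriangleright^n$ be two acyclic diagrams in normal form. If $[\![c]\!]\simeq[\![d]\!]$, then $c=_{\mathrm{PGA}}d$. -/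

import Mathlib

namespace ParityGame

/-- The two generating objects of the prop of diagrams: a wire directed to the right, a wire
directed to the left. Objects are words `List Dir`. -/
inductive Dir : Type
  | right
  | left

/-- The set of priorities `{0, ..., M}`. -/
abbrev Priority (M : ℕ) : Type := Fin (M + 1)

/-! ### Diagrams -/

/-- The generating morphisms. -/
inductive Gen (M : ℕ) : List Dir → List Dir → Type
  | player0 : Gen M [.right] [.right, .right]
  | lose0 : Gen M [.right] []
  | player1 : Gen M [.right] [.right, .right]
  | lose1 : Gen M [.right] []
  | merge : Gen M [.right, .right] [.right]
  | start : Gen M [] [.right]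
  | prio (p : Priority M) : Gen M [.right] [.right]
  | cap : Gen M [.left, .right] []
  | cup : Gen M [] [.right, .left]

/-- Terms for the morphisms of the free two-coloured prop on `Gen M`. The morphisms are the
classes of such terms modulo `StructEq` below. -/
inductive Diagram (M : ℕ) : List Dir → List Dir → Type
  | gen {v w : List Dir} (g : Gen M v w) : Diagram M v w
  | id (v : List Dir) : Diagram M v v
  | swap (v w : List Dir) : Diagram M (v ++ w) (w ++ v)
  | comp {u v w : List Dir} (c : Diagram M u v) (d : Diagram M v w) : Diagram M u w
  | tensor {v w v' w' : List Dir} (c : Diagram M v w) (d : Diagram M v' w') :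
      Diagram M (v ++ v') (w ++ w')

/-- The word made of `n` wires directed to the right. -/
abbrev rightWires (n : ℕ) : List Dir := List.replicate n Dir.right

namespace Diagram

variable {M : ℕ}

/-- `d.UsesOnly S`: `d` is composed of generators in `S`, identities and wire crossings. -/
def UsesOnly (S : ∀ ⦃v w : List Dir⦄, Gen M v w → Prop) :
    ∀ {v w : List Dir}, Diagram M v w → Prop
  | _, _, gen g => S g
  | _, _, id _ => True
  | _, _, swap _ _ => True
  | _, _, comp c d => c.UsesOnly S ∧ d.UsesOnly S
  | _, _, tensor c d => c.UsesOnly S ∧ d.UsesOnly S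

abbrev player0 : Diagram M [.right] [.right, .right] := gen .player0
abbrev lose0 : Diagram M [.right] [] := gen .lose0
abbrev player1 : Diagram M [.right] [.right, .right] := gen .player1
abbrev lose1 : Diagram M [.right] [] := gen .lose1
abbrev merge : Diagram M [.right, .right] [.right] := gen .merge
abbrev start : Diagram M [] [.right] := gen .start
abbrev prio (p : Priority M) : Diagram M [.right] [.right] := gen (.prio p)
abbrev cap : Diagram M [.left, .right] [] := gen .cap
abbrev cup : Diagram M [] [.right, .left] := gen .cup

/-- The identity on one wire directed to the right. -/
abbrev wire : Diagram M [.right] [.right] := id [.right]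

/-- The identity on one wire directed to the left. -/
abbrev wireOp : Diagram M [.left] [.left] := id [.left]

/-- The empty diagram. -/
abbrev empty : Diagram M [] [] := id []

/-- The crossing of two wires directed to the right. -/
abbrev sym : Diagram M [.right, .right] [.right, .right] := swap [.right] [.right]

/-- `id ⊗ sym ⊗ id` on four wires directed to the right. -/
abbrev midSym : Diagram M [.right, .right, .right, .right] [.right, .right, .right, .right] :=
  tensor (tensor wire sym) wire

/-- Transport of a diagram along equalities of words. -/
def retype {v w v' w' : List Dir} (d : Diagram M v w) (hv : v = v') (hw : w = w') :
    Diagram M v' w' :=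
  hv ▸ hw ▸ d

/-- The body of the loop in the parity axiom: merge the loop wire with the input, then let
Player 0 choose between the second exit and a Player 1 choice between the loop (through
priority `p`) and the first exit. -/
def parityBody (p : Priority M) : Diagram M [.right, .right] [.right, .right, .right] :=
  comp merge (comp player0 (comp (tensor player1 wire) (tensor (prio p) (id [.right, .right]))))

/-- The trace of `parityBody p` along its first wire: the left-hand side of the parity axiom. -/
def parityLoop (p : Priority M) : Diagram M [.right] [.right, .right] :=
  comp (v := [.right, .left, .right]) (tensor cup wire)
    (comp (v := [.left, .right, .right]) (tensor (swap [.right] [.left]) wire)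
      (comp (v := [.left, .right, .right, .right]) (tensor wireOp (parityBody p))
        (tensor cap (id [.right, .right]))))

end Diagram

/-! ### Equational theories -/

open Diagram

/-- Relations between diagrams. The types of the two sides are allowed to differ, because the prop
is strict: `(u ++ v) ++ w` and `u ++ (v ++ w)` are the same object, but only propositionally so.
All relations below only relate diagrams whose types are (propositionally) equal. -/
abbrev DiagramRel (M : ℕ) : Type :=
  ∀ ⦃v w v' w' : List Dir⦄, Diagram M v w → Diagram M v' w' → Prop

/-- The laws of strict symmetric monoidal categories. -/
inductive SMCLaw (M : ℕ) : DiagramRel M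
  | comp_assoc {u v w x : List Dir} (c : Diagram M u v) (d : Diagram M v w) (e : Diagram M w x) :
      SMCLaw M (comp (comp c d) e) (comp c (comp d e))
  | id_comp {v w : List Dir} (c : Diagram M v w) : SMCLaw M (comp (id v) c) c
  | comp_id {v w : List Dir} (c : Diagram M v w) : SMCLaw M (comp c (id w)) c
  | tensor_assoc {u u' v v' w w' : List Dir}
      (c : Diagram M u u') (d : Diagram M v v') (e : Diagram M w w') :
      SMCLaw M (tensor (tensor c d) e) (tensor c (tensor d e))
  | empty_tensor {v w : List Dir} (c : Diagram M v w) : SMCLaw M (tensor (id []) c) c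
  | tensor_empty {v w : List Dir} (c : Diagram M v w) : SMCLaw M (tensor c (id [])) c
  | interchange {u v w u' v' w' : List Dir} (c : Diagram M u v) (d : Diagram M v w)
      (c' : Diagram M u' v') (d' : Diagram M v' w') :
      SMCLaw M (tensor (comp c d) (comp c' d')) (comp (tensor c c') (tensor d d'))
  | id_tensor_id (v w : List Dir) : SMCLaw M (tensor (id v) (id w)) (id (v ++ w))
  | swap_natural {v w v' w' : List Dir} (c : Diagram M v w) (d : Diagram M v' w') :
      SMCLaw M (comp (tensor c d) (swap w w')) (comp (swap v v') (tensor d c))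
  | swap_swap (v w : List Dir) : SMCLaw M (comp (swap v w) (swap w v)) (id (v ++ w))
  | swap_hexagon (u v w : List Dir) :
      SMCLaw M (swap u (v ++ w))
        (comp (tensor (swap u v) (id w))
          ((tensor (id v) (swap u w)).retype (List.append_assoc v u w).symm
            (List.append_assoc v w u).symm))

/-- The axioms of Parity Game Algebra. -/
inductive PGAAxiom (M : ℕ) : DiagramRel M
  -- compact closed structure and loop removal
  | A1 : PGAAxiom M (comp (v := [.right, .left, .right]) (tensor cup wire) (tensor wire cap)) wire
  | A2 : PGAAxiom M (comp (v := [.left, .right, .left]) (tensor wireOp cup) (tensor cap wireOp)) wireOp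
  | A3 : PGAAxiom M (comp cup (comp (swap [.right] [.left]) cap)) empty
  -- distributive lattices
  | B1 : PGAAxiom M (comp (tensor wire merge) merge) (comp (tensor merge wire) merge)
  | B2 : PGAAxiom M (comp sym merge) merge
  | B3r : PGAAxiom M (comp (tensor wire start) merge) wire
  | B3l : PGAAxiom M (comp (tensor start wire) merge) wire
  | B4 : PGAAxiom M (comp player0 (tensor player0 wire)) (comp player0 (tensor wire player0))
  | B5 : PGAAxiom M (comp player0 sym) player0
  | B6r : PGAAxiom M (comp player0 (tensor lose0 wire)) wire
  | B6l : PGAAxiom M (comp player0 (tensor wire lose0)) wire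
  | B7 : PGAAxiom M (comp player1 (tensor player1 wire)) (comp player1 (tensor wire player1))
  | B8 : PGAAxiom M (comp player1 sym) player1
  | B9r : PGAAxiom M (comp player1 (tensor lose1 wire)) wire
  | B9l : PGAAxiom M (comp player1 (tensor wire lose1)) wire
  | B10 : PGAAxiom M (comp merge player0)
      (comp (tensor player0 player0) (comp midSym (tensor merge merge)))
  | B11 : PGAAxiom M (comp merge lose0) (tensor lose0 lose0)
  | B12 : PGAAxiom M (comp start player0) (tensor start start)
  | B13 : PGAAxiom M (comp start player1) (tensor start start)
  | B14 : PGAAxiom M (comp start lose0) empty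
  | B15 : PGAAxiom M (comp start lose1) empty
  | B16 : PGAAxiom M (comp player0 merge) wire
  | B17 : PGAAxiom M (comp player1 merge) wire
  | B18 : PGAAxiom M (comp merge player1)
      (comp (tensor player1 player1) (comp midSym (tensor merge merge)))
  | B19 : PGAAxiom M (comp merge lose1) (tensor lose1 lose1)
  | B20 : PGAAxiom M (comp player0 (tensor player1 wire))
      (comp player1 (comp (tensor player0 player0) (comp midSym (tensor (id [.right, .right]) merge))))
  | B21 : PGAAxiom M (comp player0 (tensor lose1 wire)) (comp lose1 start)
  | B22 : PGAAxiom M (comp player1 (tensor player0 wire))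
      (comp player0 (comp (tensor player1 player1) (comp midSym (tensor (id [.right, .right]) merge))))
  | B23 : PGAAxiom M (comp player1 (tensor lose0 wire)) (comp lose0 start)
  -- priorities
  | C1 (k : Priority M) : PGAAxiom M (comp (tensor (prio k) (prio k)) merge) (comp merge (prio k))
  | C2 (k : Priority M) : PGAAxiom M (comp start (prio k)) start
  | C3 (k l : Priority M) : PGAAxiom M (comp (prio k) (prio l)) (prio (max k l))
  | C4 : PGAAxiom M (prio 0) wire
  -- distributivity of priorities over lattices
  | D1 (k : Priority M) :
      PGAAxiom M (comp (prio k) player0) (comp player0 (tensor (prio k) (prio k)))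
  | D2 (k : Priority M) : PGAAxiom M (comp (prio k) lose0) lose0
  | D3 (k : Priority M) :
      PGAAxiom M (comp (prio k) player1) (comp player1 (tensor (prio k) (prio k)))
  | D4 (k : Priority M) : PGAAxiom M (comp (prio k) lose1) lose1
  -- parity
  | E_even (p : Priority M) (hp : Even p.val) : PGAAxiom M (parityLoop p) player0
  | E_odd (p : Priority M) (hp : Odd p.val) : PGAAxiom M (parityLoop p) (tensor start wire)

/-- The smallest congruence (with respect to both compositions) that contains `R`. -/
inductive Congruence {M : ℕ} (R : DiagramRel M) : DiagramRel M
  | of {v w v' w' : List Dir} {c : Diagram M v w} {d : Diagram M v' w'} (h : R c d) :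
      Congruence R c d
  | refl {v w : List Dir} (c : Diagram M v w) : Congruence R c c
  | symm {v w v' w' : List Dir} {c : Diagram M v w} {d : Diagram M v' w'}
      (h : Congruence R c d) : Congruence R d c
  | trans {v w v' w' v'' w'' : List Dir} {c : Diagram M v w} {d : Diagram M v' w'}
      {e : Diagram M v'' w''} (h : Congruence R c d) (h' : Congruence R d e) : Congruence R c e
  | comp {u v w u' v' w' : List Dir} {c : Diagram M u v} {d : Diagram M v w}
      {c' : Diagram M u' v'} {d' : Diagram M v' w'}
      (h : Congruence R c c') (h' : Congruence R d d') :
      Congruence R (comp c d) (comp c' d')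
  | tensor {v w x y v' w' x' y' : List Dir} {c : Diagram M v w} {d : Diagram M x y}
      {c' : Diagram M v' w'} {d' : Diagram M x' y'}
      (h : Congruence R c c') (h' : Congruence R d d') :
      Congruence R (tensor c d) (tensor c' d')

/-- Structural equivalence: equality of morphisms of the free prop. -/
def StructEq {M : ℕ} : DiagramRel M := Congruence (SMCLaw M)

/-- Provable equality in Parity Game Algebra. -/
def PGAEq {M : ℕ} : DiagramRel M :=
  Congruence fun _ _ _ _ c d => SMCLaw M c d ∨ PGAAxiom M c d

/-! ### Acyclic diagrams and normal forms -/

section Layers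

variable {M : ℕ}

inductive IsPlayer0Gen : ∀ ⦃v w : List Dir⦄, Gen M v w → Prop
  | player0 : IsPlayer0Gen .player0
  | lose0 : IsPlayer0Gen .lose0

inductive IsPlayer1Gen : ∀ ⦃v w : List Dir⦄, Gen M v w → Prop
  | player1 : IsPlayer1Gen .player1
  | lose1 : IsPlayer1Gen .lose1

inductive IsPriorityGen : ∀ ⦃v w : List Dir⦄, Gen M v w → Prop
  | prio (p : Priority M) : IsPriorityGen (.prio p)

inductive IsMergeGen : ∀ ⦃v w : List Dir⦄, Gen M v w → Prop
  | merge : IsMergeGen .merge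
  | start : IsMergeGen .start

/-- All the generators except the cap and the cup. -/
def IsAcyclicGen ⦃v w : List Dir⦄ (g : Gen M v w) : Prop :=
  IsPlayer0Gen g ∨ IsPlayer1Gen g ∨ IsPriorityGen g ∨ IsMergeGen g

/-- A diagram is acyclic if it is composed without caps and cups. (Every term that is structurally
equal to an acyclic one is acyclic.) -/
def Diagram.IsAcyclic {v w : List Dir} (d : Diagram M v w) : Prop :=
  d.UsesOnly IsAcyclicGen

/-- A diagram is in normal form if, as a morphism of the free prop, it factors into a layer of
`player0, lose0`, then `player1, lose1`, then `prio p`, then `merge, start`. -/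
def Diagram.IsNormalForm {v w : List Dir} (d : Diagram M v w) : Prop :=
  ∃ (x y z : List Dir) (d₀ : Diagram M v x) (d₁ : Diagram M x y) (d₂ : Diagram M y z)
    (d₃ : Diagram M z w),
    d₀.UsesOnly IsPlayer0Gen ∧ d₁.UsesOnly IsPlayer1Gen ∧ d₂.UsesOnly IsPriorityGen ∧
      d₃.UsesOnly IsMergeGen ∧ StructEq d (comp d₀ (comp d₁ (comp d₂ d₃)))

end Layers

/-! ### Open parity games -/

/-- The positions of the word `v` at which the letter is `a`. -/
abbrev Port (v : List Dir) (a : Dir) : Type := {k : Fin v.length // v.get k = a}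

namespace Port

variable {u v : List Dir} {a : Dir}

/-- The positions of `u`, as positions of `u ++ v`. -/
def inl (p : Port u a) : Port (u ++ v) a :=
  ⟨⟨p.1.val, by have := p.1.isLt; simp; omega⟩, by
    have h := p.2
    simp only [List.get_eq_getElem] at h ⊢
    rw [List.getElem_append_left p.1.isLt]
    exact h⟩

/-- The positions of `v`, as positions of `u ++ v`. -/
def inr (p : Port v a) : Port (u ++ v) a :=
  ⟨⟨u.length + p.1.val, by have := p.1.isLt; simp⟩, by
    have h := p.2
    simp only [List.get_eq_getElem] at h ⊢
    rw [List.getElem_append_right (by omega)]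
    simpa using h⟩

theorem inl_or_inr_bijective :
    Function.Bijective (Sum.elim inl inr : Port u a ⊕ Port v a → Port (u ++ v) a) := by
  constructor
  · rintro (⟨⟨p, hp⟩, hp'⟩ | ⟨⟨p, hp⟩, hp'⟩) (⟨⟨q, hq⟩, hq'⟩ | ⟨⟨q, hq⟩, hq'⟩) h <;>
      simp [inl, inr] at h ⊢ <;> omega
  · rintro ⟨⟨p, hp⟩, hp'⟩
    by_cases h : p < u.length
    · refine ⟨Sum.inl ⟨⟨p, h⟩, ?_⟩, rfl⟩
      simp only [List.get_eq_getElem] at hp' ⊢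
      rwa [List.getElem_append_left h] at hp'
    · refine ⟨Sum.inr ⟨⟨p - u.length, by simp at hp; omega⟩, ?_⟩, ?_⟩
      · simp only [List.get_eq_getElem] at hp' ⊢
        rwa [List.getElem_append_right (by omega)] at hp'
      · simp only [Sum.elim_inr, inr, Subtype.mk.injEq, Fin.mk.injEq]
        omega

/-- The positions of `u ++ v` are those of `u`, followed by those of `v`. -/
noncomputable def append (u v : List Dir) (a : Dir) : Port u a ⊕ Port v a ≃ Port (u ++ v) a :=
  Equiv.ofBijective _ inl_or_inr_bijective

/-- The block transposition of positions. -/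
noncomputable def swap (u v : List Dir) (a : Dir) : Port (u ++ v) a ≃ Port (v ++ u) a :=
  (append u v a).symm.trans ((Equiv.sumComm _ _).trans (append v u a))

end Port

/-- The entry positions (inputs) of a game of type `v → w`: the right-directed wires of `v` and the
left-directed wires of `w`. -/
abbrev Entry (v w : List Dir) : Type := Port v .right ⊕ Port w .left

/-- The exit positions (outputs) of a game of type `v → w`: the left-directed wires of `v` and the
right-directed wires of `w`. -/
abbrev Exit (v w : List Dir) : Type := Port v .left ⊕ Port w .right

/-- Open parity games. The interface on each side is a word of directed wires. -/
structure Game (M : ℕ) (v w : List Dir) where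
  /-- internal positions -/
  V : Type
  finite_V : Finite V
  /-- the positions of Player 0; the others belong to Player 1 -/
  V₀ : Set V
  /-- the edges -/
  E : Entry v w ⊕ V → V ⊕ Exit v w → Prop
  entry_unique : ∀ i : Entry v w, ∃! y, E (Sum.inl i) y
  exit_unique : ∀ o : Exit v w, ∃! x, E x (Sum.inr o)
  label : V → Priority M

/-! ### Operations on open parity games -/

/-- Given one-step links `J` between sources `S`, intermediate points `I` and targets `T`,
`Through J x t` says that there is a path from `x` to `t` all of whose intermediate points
are in `I`. -/
inductive Through {S I T : Type} (J : S ⊕ I → I ⊕ T → Prop) : S ⊕ I → T → Prop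
  | last {x : S ⊕ I} {t : T} (h : J x (Sum.inr t)) : Through J x t
  | step {x : S ⊕ I} {i : I} {t : T} (h : J x (Sum.inl i)) (h' : Through J (Sum.inr i) t) :
      Through J x t

namespace Through

variable {S I T : Type} {J : S ⊕ I → I ⊕ T → Prop}

theorem existsUnique [Finite I] {s : S} (h₁ : ∃! y, J (Sum.inl s) y)
    (h₂ : ∀ i, ∃! y, J (Sum.inr i) y) (h₃ : ∀ i, ∃! x, J x (Sum.inl i)) :
    ∃! t, Through J (Sum.inl s) t := by
  have huniq : ∀ x : S ⊕ I, (∃! y, J x y) → ∀ t, Through J x t → ∀ t', Through J x t' → t = t' := by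
    intro x hx t ht
    induction ht with
    | last h =>
      intro t' ht'
      cases ht' with
      | last h' => exact Sum.inr_injective (hx.unique h h')
      | step h' _ => exact absurd (hx.unique h h') (by simp)
    | step h _ ih =>
      intro t' ht'
      cases ht' with
      | last h' => exact absurd (hx.unique h h') (by simp)
      | step h' h'' =>
        have := Sum.inl_injective (hx.unique h h')
        subst this
        exact ih (h₂ _) t' h''
  have hex : ∃ t, Through J (Sum.inl s) t := by
    by_contra hno
    let Bad : Type := {i : I // ¬ ∃ t, Through J (Sum.inr i) t}
    have hnext : ∀ b : Bad, ∃ b' : Bad, J (Sum.inr b.1) (Sum.inl b'.1) := by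
      rintro ⟨i, hi⟩
      obtain ⟨y | t, hy, -⟩ := h₂ i
      · exact ⟨⟨y, fun ⟨t, ht⟩ => hi ⟨t, .step hy ht⟩⟩, hy⟩
      · exact absurd ⟨t, .last hy⟩ hi
    choose g hg using hnext
    have hinj : Function.Injective g := by
      intro a b hab
      have h1 := hg a
      have h2 := hg b
      rw [← hab] at h2
      exact Subtype.ext (Sum.inr_injective ((h₃ _).unique h1 h2))
    have hsurj : Function.Surjective g := Finite.surjective_of_injective hinj
    obtain ⟨y | t, hy, -⟩ := h₁
    · obtain ⟨b, hb⟩ := hsurj ⟨y, fun ⟨t, ht⟩ => hno ⟨t, .step hy ht⟩⟩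
      have h1 := hg b
      rw [hb] at h1
      exact absurd ((h₃ _).unique hy h1) (by simp)
    · exact hno ⟨t, .last hy⟩
  obtain ⟨t, ht⟩ := hex
  exact ⟨t, ht, fun t' ht' => huniq _ h₁ _ ht' _ ht⟩

theorem reverse {s : S} {t : T} (h : Through J (Sum.inl s) t) :
    Through (fun x y => J y.swap x.swap) (Sum.inl t) s := by
  have key : ∀ x, Through J x t →
      (∀ s' : S, x = Sum.inl s' → Through (fun x y => J y.swap x.swap) (Sum.inl t) s') ∧
      (∀ (i : I) (s' : S), x = Sum.inr i → Through (fun x y => J y.swap x.swap) (Sum.inr i) s' →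
        Through (fun x y => J y.swap x.swap) (Sum.inl t) s') := by
    clear h
    intro x hx
    induction hx with
    | last h =>
      refine ⟨?_, ?_⟩
      · rintro s' rfl; exact .last h
      · rintro i s' rfl h'; exact .step h h'
    | step h _ ih =>
      refine ⟨?_, ?_⟩
      · rintro s' rfl; exact ih.2 _ _ rfl (.last h)
      · rintro i s' rfl h'; exact ih.2 _ _ rfl (.step h h')
  exact (key _ h).1 _ rfl

theorem existsUnique_source [Finite I] {t : T} (h₁ : ∃! x, J x (Sum.inr t))
    (h₂ : ∀ i, ∃! y, J (Sum.inr i) y) (h₃ : ∀ i, ∃! x, J x (Sum.inl i)) :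
    ∃! s, Through J (Sum.inl s) t := by
  have hswap : ∀ {A B : Type} {P : A ⊕ B → Prop}, (∃! x, P x) → ∃! x : B ⊕ A, P x.swap := by
    rintro A B P ⟨x, hx, hu⟩
    refine ⟨x.swap, by simpa using hx, fun y hy => ?_⟩
    rw [← hu _ hy, Sum.swap_swap]
  obtain ⟨s, hs, hu⟩ := existsUnique (J := fun x y => J y.swap x.swap) (s := t)
    (hswap h₁) (fun i => hswap (h₃ i)) (fun i => hswap (h₂ i))
  refine ⟨s, by simpa using hs.reverse, fun s' hs' => hu _ hs'.reverse⟩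

end Through

namespace Game

variable {M : ℕ}

/-- The game with a single internal position, of Player 0 if `owner₀` and of Player 1 otherwise,
with priority `p`, to which all entries lead and which leads to all exits. -/
def single (v w : List Dir) (owner₀ : Prop) (p : Priority M) : Game M v w where
  V := Unit
  finite_V := inferInstance
  V₀ := {_x | owner₀}
  E
    | Sum.inl _, Sum.inl _ => True
    | Sum.inr _, Sum.inr _ => True
    | _, _ => False
  entry_unique i := ⟨Sum.inl (), trivial, by rintro (_ | _) h; exacts [rfl, h.elim]⟩
  exit_unique o := ⟨Sum.inr (), trivial, by rintro (_ | _) h; exacts [h.elim, rfl]⟩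
  label _ := p

/-- The game without internal positions, in which the edges match the entries with the exits. -/
def wires {v w : List Dir} (e : Entry v w ≃ Exit v w) : Game M v w where
  V := Empty
  finite_V := inferInstance
  V₀ := ∅
  E
    | Sum.inl i, Sum.inr o => e i = o
    | _, _ => False
  entry_unique i := ⟨Sum.inr (e i), rfl, by rintro (_ | _) h; exacts [h.elim, by rw [h]]⟩
  exit_unique o := ⟨Sum.inl (e.symm o), e.apply_symm_apply o, by
    rintro (_ | _) h
    · rw [← show e _ = o from h, e.symm_apply_apply]
    · exact h.elim⟩
  label := Empty.elim

/-- The identity game. -/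
def id (v : List Dir) : Game M v v := wires (Equiv.sumComm _ _)

/-- The swap game. -/
noncomputable def swap (v w : List Dir) : Game M (v ++ w) (w ++ v) :=
  wires ((Equiv.sumCongr (Port.swap v w .right) (Port.swap w v .left)).trans (Equiv.sumComm _ _))

section Comp

variable {u v w : List Dir}

/-- The wires in the middle of a composition: those from the first game to the second and
those from the second game to the first. -/
abbrev Mid (v : List Dir) : Type := Port v .right ⊕ Port v .left

/-- The sources of edges of the first game, inside the composition. -/
def srcFst {X : Type} (Y : Type) (w : List Dir) :
    Entry u v ⊕ X → (Entry u w ⊕ (X ⊕ Y)) ⊕ Mid v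
  | Sum.inl (Sum.inl p) => Sum.inl (Sum.inl (Sum.inl p))
  | Sum.inl (Sum.inr p) => Sum.inr (Sum.inr p)
  | Sum.inr x => Sum.inl (Sum.inr (Sum.inl x))

/-- The targets of edges of the first game, inside the composition. -/
def tgtFst {X : Type} (Y : Type) (w : List Dir) :
    X ⊕ Exit u v → Mid v ⊕ ((X ⊕ Y) ⊕ Exit u w)
  | Sum.inl x => Sum.inr (Sum.inl (Sum.inl x))
  | Sum.inr (Sum.inl p) => Sum.inr (Sum.inr (Sum.inl p))
  | Sum.inr (Sum.inr p) => Sum.inl (Sum.inl p)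

/-- The sources of edges of the second game, inside the composition. -/
def srcSnd {Y : Type} (X : Type) (u : List Dir) :
    Entry v w ⊕ Y → (Entry u w ⊕ (X ⊕ Y)) ⊕ Mid v
  | Sum.inl (Sum.inl p) => Sum.inr (Sum.inl p)
  | Sum.inl (Sum.inr p) => Sum.inl (Sum.inl (Sum.inr p))
  | Sum.inr y => Sum.inl (Sum.inr (Sum.inr y))

/-- The targets of edges of the second game, inside the composition. -/
def tgtSnd {Y : Type} (X : Type) (u : List Dir) :
    Y ⊕ Exit v w → Mid v ⊕ ((X ⊕ Y) ⊕ Exit u w)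
  | Sum.inl y => Sum.inr (Sum.inl (Sum.inr y))
  | Sum.inr (Sum.inl p) => Sum.inl (Sum.inr p)
  | Sum.inr (Sum.inr p) => Sum.inr (Sum.inr (Sum.inr p))

/-- The edges of the two games, glued along the middle wires. -/
inductive Glue (A : Game M u v) (B : Game M v w) :
    (Entry u w ⊕ (A.V ⊕ B.V)) ⊕ Mid v → Mid v ⊕ ((A.V ⊕ B.V) ⊕ Exit u w) → Prop
  | fst {x y} (h : A.E x y) : Glue A B (srcFst B.V w x) (tgtFst B.V w y)
  | snd {x y} (h : B.E x y) : Glue A B (srcSnd A.V u x) (tgtSnd A.V u y)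

theorem glue_entry (A : Game M u v) (B : Game M v w) (i : Entry u w) :
    ∃! y, Glue A B (Sum.inl (Sum.inl i)) y := by
  rcases i with p | p
  · obtain ⟨y, hy, hu⟩ := A.entry_unique (Sum.inl p)
    refine ⟨tgtFst B.V w y, Glue.fst (x := Sum.inl (Sum.inl p)) hy, fun z hz => ?_⟩
    generalize hs : (Sum.inl (Sum.inl (Sum.inl p)) : (Entry u w ⊕ (A.V ⊕ B.V)) ⊕ Mid v) = s at hz
    rcases hz with @⟨x, y', h⟩ | @⟨x, y', h⟩ <;> rcases x with (x | x) | x <;>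
      simp [srcFst, srcSnd] at hs
    subst hs
    rw [hu _ h]
  · obtain ⟨y, hy, hu⟩ := B.entry_unique (Sum.inr p)
    refine ⟨tgtSnd A.V u y, Glue.snd (x := Sum.inl (Sum.inr p)) hy, fun z hz => ?_⟩
    generalize hs : (Sum.inl (Sum.inl (Sum.inr p)) : (Entry u w ⊕ (A.V ⊕ B.V)) ⊕ Mid v) = s at hz
    rcases hz with @⟨x, y', h⟩ | @⟨x, y', h⟩ <;> rcases x with (x | x) | x <;>
      simp [srcFst, srcSnd] at hs
    subst hs
    rw [hu _ h]

theorem glue_mid_out (A : Game M u v) (B : Game M v w) (m : Mid v) :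
    ∃! y, Glue A B (Sum.inr m) y := by
  rcases m with p | p
  · obtain ⟨y, hy, hu⟩ := B.entry_unique (Sum.inl p)
    refine ⟨tgtSnd A.V u y, Glue.snd (x := Sum.inl (Sum.inl p)) hy, fun z hz => ?_⟩
    generalize hs : (Sum.inr (Sum.inl p) : (Entry u w ⊕ (A.V ⊕ B.V)) ⊕ Mid v) = s at hz
    rcases hz with @⟨x, y', h⟩ | @⟨x, y', h⟩ <;> rcases x with (x | x) | x <;>
      simp [srcFst, srcSnd] at hs
    subst hs
    rw [hu _ h]
  · obtain ⟨y, hy, hu⟩ := A.entry_unique (Sum.inr p)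
    refine ⟨tgtFst B.V w y, Glue.fst (x := Sum.inl (Sum.inr p)) hy, fun z hz => ?_⟩
    generalize hs : (Sum.inr (Sum.inr p) : (Entry u w ⊕ (A.V ⊕ B.V)) ⊕ Mid v) = s at hz
    rcases hz with @⟨x, y', h⟩ | @⟨x, y', h⟩ <;> rcases x with (x | x) | x <;>
      simp [srcFst, srcSnd] at hs
    subst hs
    rw [hu _ h]

theorem glue_mid_in (A : Game M u v) (B : Game M v w) (m : Mid v) :
    ∃! x, Glue A B x (Sum.inl m) := by
  rcases m with p | p
  · obtain ⟨x, hx, hu⟩ := A.exit_unique (Sum.inr p)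
    refine ⟨srcFst B.V w x, Glue.fst (y := Sum.inr (Sum.inr p)) hx, fun z hz => ?_⟩
    generalize hs : (Sum.inl (Sum.inl p) : Mid v ⊕ ((A.V ⊕ B.V) ⊕ Exit u w)) = s at hz
    rcases hz with @⟨x', y, h⟩ | @⟨x', y, h⟩ <;> rcases y with y | (y | y) <;>
      simp [tgtFst, tgtSnd] at hs
    subst hs
    rw [hu _ h]
  · obtain ⟨x, hx, hu⟩ := B.exit_unique (Sum.inl p)
    refine ⟨srcSnd A.V u x, Glue.snd (y := Sum.inr (Sum.inl p)) hx, fun z hz => ?_⟩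
    generalize hs : (Sum.inl (Sum.inr p) : Mid v ⊕ ((A.V ⊕ B.V) ⊕ Exit u w)) = s at hz
    rcases hz with @⟨x', y, h⟩ | @⟨x', y, h⟩ <;> rcases y with y | (y | y) <;>
      simp [tgtFst, tgtSnd] at hs
    subst hs
    rw [hu _ h]

theorem glue_exit (A : Game M u v) (B : Game M v w) (o : Exit u w) :
    ∃! x, Glue A B x (Sum.inr (Sum.inr o)) := by
  rcases o with p | p
  · obtain ⟨x, hx, hu⟩ := A.exit_unique (Sum.inl p)
    refine ⟨srcFst B.V w x, Glue.fst (y := Sum.inr (Sum.inl p)) hx, fun z hz => ?_⟩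
    generalize hs : (Sum.inr (Sum.inr (Sum.inl p)) : Mid v ⊕ ((A.V ⊕ B.V) ⊕ Exit u w)) = s at hz
    rcases hz with @⟨x', y, h⟩ | @⟨x', y, h⟩ <;> rcases y with y | (y | y) <;>
      simp [tgtFst, tgtSnd] at hs
    subst hs
    rw [hu _ h]
  · obtain ⟨x, hx, hu⟩ := B.exit_unique (Sum.inr p)
    refine ⟨srcSnd A.V u x, Glue.snd (y := Sum.inr (Sum.inr p)) hx, fun z hz => ?_⟩
    generalize hs : (Sum.inr (Sum.inr (Sum.inr p)) : Mid v ⊕ ((A.V ⊕ B.V) ⊕ Exit u w)) = s at hz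
    rcases hz with @⟨x', y, h⟩ | @⟨x', y, h⟩ <;> rcases y with y | (y | y) <;>
      simp [tgtFst, tgtSnd] at hs
    subst hs
    rw [hu _ h]

/-- Composition: the middle wires are hidden, and each path through them becomes an edge. -/
def comp (A : Game M u v) (B : Game M v w) : Game M u w where
  V := A.V ⊕ B.V
  finite_V := by
    have := A.finite_V
    have := B.finite_V
    infer_instance
  V₀ := {x | Sum.elim (· ∈ A.V₀) (· ∈ B.V₀) x}
  E x y := Through (Glue A B) (Sum.inl x) y
  entry_unique i := Through.existsUnique (glue_entry A B i) (glue_mid_out A B) (glue_mid_in A B)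
  exit_unique o :=
    Through.existsUnique_source (glue_exit A B o) (glue_mid_out A B) (glue_mid_in A B)
  label := Sum.elim A.label B.label

end Comp

section Tensor

variable {v w v' w' : List Dir}

/-- The entries of a juxtaposition. -/
noncomputable def tensorEntry (v w v' w' : List Dir) :
    Entry v w ⊕ Entry v' w' ≃ Entry (v ++ v') (w ++ w') :=
  (Equiv.sumSumSumComm _ _ _ _).trans
    (Equiv.sumCongr (Port.append v v' .right) (Port.append w w' .left))

/-- The exits of a juxtaposition. -/
noncomputable def tensorExit (v w v' w' : List Dir) :
    Exit v w ⊕ Exit v' w' ≃ Exit (v ++ v') (w ++ w') :=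
  (Equiv.sumSumSumComm _ _ _ _).trans
    (Equiv.sumCongr (Port.append v v' .left) (Port.append w w' .right))

/-- The edges of a juxtaposition: those of both games, with renumbered entries and exits. -/
inductive TensorEdge (A : Game M v w) (B : Game M v' w') :
    Entry (v ++ v') (w ++ w') ⊕ (A.V ⊕ B.V) → (A.V ⊕ B.V) ⊕ Exit (v ++ v') (w ++ w') → Prop
  | fst {x y} (h : A.E x y) :
      TensorEdge A B (Sum.map (fun i => tensorEntry v w v' w' (Sum.inl i)) Sum.inl x)
        (Sum.map Sum.inl (fun o => tensorExit v w v' w' (Sum.inl o)) y)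
  | snd {x y} (h : B.E x y) :
      TensorEdge A B (Sum.map (fun i => tensorEntry v w v' w' (Sum.inr i)) Sum.inr x)
        (Sum.map Sum.inr (fun o => tensorExit v w v' w' (Sum.inr o)) y)

theorem tensorEdge_entry (A : Game M v w) (B : Game M v' w') (i : Entry (v ++ v') (w ++ w')) :
    ∃! y, TensorEdge A B (Sum.inl i) y := by
  obtain ⟨j, rfl⟩ := (tensorEntry v w v' w').surjective i
  rcases j with j | j
  · obtain ⟨y, hy, hu⟩ := A.entry_unique j
    refine ⟨_, TensorEdge.fst hy, fun z hz => ?_⟩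
    generalize hs : (Sum.inl (tensorEntry v w v' w' (Sum.inl j)) :
      Entry (v ++ v') (w ++ w') ⊕ (A.V ⊕ B.V)) = s at hz
    rcases hz with @⟨x, y', h⟩ | @⟨x, y', h⟩ <;> rcases x with x | x <;> simp at hs
    subst hs
    rw [hu _ h]
  · obtain ⟨y, hy, hu⟩ := B.entry_unique j
    refine ⟨_, TensorEdge.snd hy, fun z hz => ?_⟩
    generalize hs : (Sum.inl (tensorEntry v w v' w' (Sum.inr j)) :
      Entry (v ++ v') (w ++ w') ⊕ (A.V ⊕ B.V)) = s at hz
    rcases hz with @⟨x, y', h⟩ | @⟨x, y', h⟩ <;> rcases x with x | x <;> simp at hs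
    subst hs
    rw [hu _ h]

theorem tensorEdge_exit (A : Game M v w) (B : Game M v' w') (o : Exit (v ++ v') (w ++ w')) :
    ∃! x, TensorEdge A B x (Sum.inr o) := by
  obtain ⟨j, rfl⟩ := (tensorExit v w v' w').surjective o
  rcases j with j | j
  · obtain ⟨x, hx, hu⟩ := A.exit_unique j
    refine ⟨_, TensorEdge.fst hx, fun z hz => ?_⟩
    generalize hs : (Sum.inr (tensorExit v w v' w' (Sum.inl j)) :
      (A.V ⊕ B.V) ⊕ Exit (v ++ v') (w ++ w')) = s at hz
    rcases hz with @⟨x', y, h⟩ | @⟨x', y, h⟩ <;> rcases y with y | y <;> simp at hs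
    subst hs
    rw [hu _ h]
  · obtain ⟨x, hx, hu⟩ := B.exit_unique j
    refine ⟨_, TensorEdge.snd hx, fun z hz => ?_⟩
    generalize hs : (Sum.inr (tensorExit v w v' w' (Sum.inr j)) :
      (A.V ⊕ B.V) ⊕ Exit (v ++ v') (w ++ w')) = s at hz
    rcases hz with @⟨x', y, h⟩ | @⟨x', y, h⟩ <;> rcases y with y | y <;> simp at hs
    subst hs
    rw [hu _ h]

/-- Monoidal product: juxtaposition. -/
noncomputable def tensor (A : Game M v w) (B : Game M v' w') : Game M (v ++ v') (w ++ w') where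
  V := A.V ⊕ B.V
  finite_V := by
    have := A.finite_V
    have := B.finite_V
    infer_instance
  V₀ := {x | Sum.elim (· ∈ A.V₀) (· ∈ B.V₀) x}
  E := TensorEdge A B
  entry_unique := tensorEdge_entry A B
  exit_unique := tensorEdge_exit A B
  label := Sum.elim A.label B.label

end Tensor

/-! ### Plays, strategies and the semantics of games -/

section Semantics

variable {v w : List Dir} (A : Game M v w)

/-- A strategy of the player who owns the positions `P`: from the past of the play and the current
position in `P`, it chooses the next position, along an edge. (At a position without outgoing edge
there is nothing to choose, and the play stops there.) -/
structure Strategy (P : Set A.V) where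
  next : List (Entry v w ⊕ A.V) → P → A.V ⊕ Exit v w
  next_edge : ∀ (h : List (Entry v w ⊕ A.V)) (x : P),
    (∃ y, A.E (Sum.inr x.1) y) → A.E (Sum.inr x.1) (next h x)

/-- A finite play, given by its last position and by the list of the previous ones. -/
structure Stage where
  past : List (Entry v w ⊕ A.V)
  current : (Entry v w ⊕ A.V) ⊕ Exit v w

/-- Extension of a finite play by moving to the target of an edge. -/
def Stage.move (h : List (Entry v w ⊕ A.V)) (x : Entry v w ⊕ A.V) (y : A.V ⊕ Exit v w) :
    Stage A :=
  ⟨h ++ [x], Sum.map Sum.inr _root_.id y⟩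

/-- The position to which the unique edge out of an entry position leads. -/
noncomputable def entryNext (i : Entry v w) : A.V ⊕ Exit v w := (A.entry_unique i).choose

open Classical in
/-- One more move of the play induced by two strategies; `none` if no move is possible. -/
noncomputable def nextStage (σ₀ : A.Strategy A.V₀) (σ₁ : A.Strategy A.V₀ᶜ) :
    Stage A → Option (Stage A)
  | ⟨_, Sum.inr _⟩ => none
  | ⟨h, Sum.inl (Sum.inl i)⟩ => some (Stage.move A h (Sum.inl i) (A.entryNext i))
  | ⟨h, Sum.inl (Sum.inr x)⟩ =>
    if ∃ y, A.E (Sum.inr x) y then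
      some (Stage.move A h (Sum.inr x)
        (if hx : x ∈ A.V₀ then σ₀.next h ⟨x, hx⟩ else σ₁.next h ⟨x, hx⟩))
    else none

/-- The play induced by two strategies from the entry position `i`, after `n` moves; `none` if it
has stopped before. -/
noncomputable def play (σ₀ : A.Strategy A.V₀) (σ₁ : A.Strategy A.V₀ᶜ) (i : Entry v w) :
    ℕ → Option (Stage A)
  | 0 => some ⟨[], Sum.inl (Sum.inl i)⟩
  | n + 1 => (play σ₀ σ₁ i n).bind (A.nextStage σ₀ σ₁)

/-- The maximum of the priorities of the internal positions in a list (`0` if there are none). -/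
def maxPriority : List (Entry v w ⊕ A.V) → Priority M
  | [] => 0
  | Sum.inl _ :: h => maxPriority h
  | Sum.inr x :: h => max (A.label x) (maxPriority h)

/-- The priority `p` occurs infinitely often in the play. -/
def OccursInfinitelyOften (σ₀ : A.Strategy A.V₀) (σ₁ : A.Strategy A.V₀ᶜ) (i : Entry v w)
    (p : Priority M) : Prop :=
  ∃ᶠ n in Filter.atTop, ∃ h x, A.play σ₀ σ₁ i n = some ⟨h, Sum.inl (Sum.inr x)⟩ ∧ A.label x = p

/-- The priority `p` is the greatest one that occurs infinitely often in the play. -/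
def IsLimsupPriority (σ₀ : A.Strategy A.V₀) (σ₁ : A.Strategy A.V₀ᶜ) (i : Entry v w)
    (p : Priority M) : Prop :=
  IsGreatest {q | A.OccursInfinitelyOften σ₀ σ₁ i q} p

/-- Denotations of plays: `top` if Player 0 wins, `bot` if Player 1 wins, and an exit position with
a priority if the play leaves the game. -/
inductive Denotation (M : ℕ) (v w : List Dir) : Type
  | exit (o : Exit v w) (k : Priority M)
  | top
  | bot

/-- `PlayDenotes A σ₀ σ₁ i t`: the play induced by `σ₀` and `σ₁` from `i` has denotation `t`. A play
that stops at an internal position is lost by the owner of that position. -/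
inductive PlayDenotes (σ₀ : A.Strategy A.V₀) (σ₁ : A.Strategy A.V₀ᶜ) (i : Entry v w) :
    Denotation M v w → Prop
  | exit {n : ℕ} {h : List (Entry v w ⊕ A.V)} {o : Exit v w}
      (hn : A.play σ₀ σ₁ i n = some ⟨h, Sum.inr o⟩) :
      PlayDenotes σ₀ σ₁ i (.exit o (A.maxPriority h))
  | stuck₀ {n : ℕ} {h : List (Entry v w ⊕ A.V)} {x : A.V}
      (hn : A.play σ₀ σ₁ i n = some ⟨h, Sum.inl (Sum.inr x)⟩)
      (hx : x ∈ A.V₀) (hstuck : ¬ ∃ y, A.E (Sum.inr x) y) : PlayDenotes σ₀ σ₁ i .bot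
  | stuck₁ {n : ℕ} {h : List (Entry v w ⊕ A.V)} {x : A.V}
      (hn : A.play σ₀ σ₁ i n = some ⟨h, Sum.inl (Sum.inr x)⟩)
      (hx : x ∉ A.V₀) (hstuck : ¬ ∃ y, A.E (Sum.inr x) y) : PlayDenotes σ₀ σ₁ i .top
  | even {p : Priority M} (hinf : ∀ n, A.play σ₀ σ₁ i n ≠ none)
      (hp : A.IsLimsupPriority σ₀ σ₁ i p) (heven : Even p.val) : PlayDenotes σ₀ σ₁ i .top
  | odd {p : Priority M} (hinf : ∀ n, A.play σ₀ σ₁ i n ≠ none)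
      (hp : A.IsLimsupPriority σ₀ σ₁ i p) (hodd : Odd p.val) : PlayDenotes σ₀ σ₁ i .bot

/-- The denotation of an entry position and a strategy of Player 0 is `lose`. -/
def IsLosing (i : Entry v w) (σ₀ : A.Strategy A.V₀) : Prop :=
  ∃ σ₁ : A.Strategy A.V₀ᶜ, A.PlayDenotes σ₀ σ₁ i .bot

/-- The denotation of an entry position and a strategy of Player 0 which is not losing. -/
def outcomes (i : Entry v w) (σ₀ : A.Strategy A.V₀) : Set (Exit v w × Priority M) :=
  {e | ∃ σ₁ : A.Strategy A.V₀ᶜ, A.PlayDenotes σ₀ σ₁ i (.exit e.1 e.2)}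

/-- The semantics of an open parity game. -/
def semantics : Set (Set (Exit v w × Priority M) × Entry v w) :=
  {x | ∃ σ₀ : A.Strategy A.V₀, ¬ A.IsLosing x.2 σ₀ ∧ A.outcomes x.2 σ₀ ⊆ x.1}

/-- Equivalence of open parity games. -/
def Equivalent (A B : Game M v w) : Prop := A.semantics = B.semantics

end Semantics

end Game

/-! ### Interpretation of diagrams -/

/-- The game without internal positions whose entries all lead to all exits, for types with exactly
one entry and exactly one exit: a bent wire. -/
def Game.bentWire {M : ℕ} (v w : List Dir) (hi : ∃! _i : Entry v w, True)
    (ho : ∃! _o : Exit v w, True) : Game M v w where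
  V := Empty
  finite_V := inferInstance
  V₀ := ∅
  E
    | Sum.inl _, Sum.inr _ => True
    | _, _ => False
  entry_unique _ := by
    obtain ⟨o, -, ho⟩ := ho
    refine ⟨Sum.inr o, trivial, ?_⟩
    rintro (y | y) h
    exacts [h.elim, by rw [ho y trivial]]
  exit_unique _ := by
    obtain ⟨i, -, hi⟩ := hi
    refine ⟨Sum.inl i, trivial, ?_⟩
    rintro (y | y) h
    exacts [by rw [hi y trivial], h.elim]
  label := Empty.elim

theorem cap_entry : ∃! _i : Entry [.left, .right] [], True := by
  refine ⟨Sum.inl ⟨1, rfl⟩, trivial, ?_⟩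
  rintro (⟨⟨_ | _ | k, hk⟩, h⟩ | ⟨k, hk⟩) -
  · cases h
  · rfl
  · simp at hk
  · exact k.elim0

theorem cap_exit : ∃! _o : Exit [.left, .right] [], True := by
  refine ⟨Sum.inl ⟨0, rfl⟩, trivial, ?_⟩
  rintro (⟨⟨_ | _ | k, hk⟩, h⟩ | ⟨k, hk⟩) -
  · rfl
  · cases h
  · simp at hk
  · exact k.elim0

theorem cup_entry : ∃! _i : Entry [] [.right, .left], True := by
  refine ⟨Sum.inr ⟨1, rfl⟩, trivial, ?_⟩
  rintro (⟨k, hk⟩ | ⟨⟨_ | _ | k, hk⟩, h⟩) -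
  · exact k.elim0
  · cases h
  · rfl
  · simp at hk

theorem cup_exit : ∃! _o : Exit [] [.right, .left], True := by
  refine ⟨Sum.inr ⟨0, rfl⟩, trivial, ?_⟩
  rintro (⟨k, hk⟩ | ⟨⟨_ | _ | k, hk⟩, h⟩) -
  · exact k.elim0
  · rfl
  · cases h
  · simp at hk

/-- The interpretation of the generators. -/
def Gen.toGame {M : ℕ} : ∀ {v w : List Dir}, Gen M v w → Game M v w
  | _, _, player0 => Game.single _ _ True 0
  | _, _, lose0 => Game.single _ _ True 0
  | _, _, player1 => Game.single _ _ False 0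
  | _, _, lose1 => Game.single _ _ False 0
  | _, _, merge => Game.single _ _ False 0
  | _, _, start => Game.single _ _ False 0
  | _, _, prio p => Game.single _ _ False p
  | _, _, cap => Game.bentWire _ _ cap_entry cap_exit
  | _, _, cup => Game.bentWire _ _ cup_entry cup_exit

/-- The interpretation of diagrams as open parity games. -/
noncomputable def Diagram.toGame {M : ℕ} : ∀ {v w : List Dir}, Diagram M v w → Game M v w
  | _, _, gen g => g.toGame
  | _, _, id v => Game.id v
  | _, _, swap v w => Game.swap v w
  | _, _, comp c d => c.toGame.comp d.toGame
  | _, _, tensor c d => c.toGame.tensor d.toGame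

end ParityGame

namespace ParityGame

open CategoryTheory MonoidalCategory

/-! ### Diagrams modulo provable equality as a symmetric monoidal category -/

section Word

variable {M : ℕ}

/-! A diagram can be read backwards: values on its outgoing wires determine values on its incoming
wires. A choice of Player 0 is a join, a choice of Player 1 a meet, `merge` copies a value, `start`
discards one, and a priority acts by an endomorphism. For acyclic diagrams between words of right
wires, this reading is determined by the semantics and in turn determines the class modulo provable
equality.

Algebra. Modulo provable equality, words form a symmetric monoidal category in which the wire is a
commutative monoid object. The equations for choices and priorities make both choices cocommutative
comonoids by monoid homomorphisms, each distributing over the other. By convolution, the monoid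
homomorphisms from the wire to a commutative monoid object thus form a bounded distributive lattice
with an action of the priorities. Composing an acyclic diagram with a copairing of such
homomorphisms applies its interpretation to the components (`Word.cls_comp_copair`). The identity of
a word of right wires is the copairing of its coprojections, so an acyclic diagram is recovered from
its interpretation in one such lattice (`PGAEq.of_interp`).

Separation. Prime ideals separate the points of a distributive lattice. A prime ideal `J` gives the
equivariant homomorphism sending `a` to the function `k ↦ act k a ∉ J`, so it is enough to compare
interpretations in `Priority M → Prop` (`Diagram.interp_eq_of_prop`).

Games. An element of that lattice tells for which `k` Player 0 can guarantee the goal from a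
position when `k` is the greatest priority seen so far. The game of an acyclic diagram has no
infinite plays, so these truth values are found by backward induction from the exits
(`Game.IsSolution.mem_semantics`), and this induction is the interpretation
(`Diagram.exists_isSolution`). -/

theorem Congruence.words_eq {R : DiagramRel M}
    (hR : ∀ ⦃v w v' w' : List Dir⦄ {c : Diagram M v w} {d : Diagram M v' w'}, R c d →
      v = v' ∧ w = w')
    {v w v' w' : List Dir} {c : Diagram M v w} {d : Diagram M v' w'} (h : Congruence R c d) :
    v = v' ∧ w = w' := by
  induction h with
  | of h => exact hR h
  | refl => exact ⟨rfl, rfl⟩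
  | symm _ ih => exact ⟨ih.1.symm, ih.2.symm⟩
  | trans _ _ ih ih' => exact ⟨ih.1.trans ih'.1, ih.2.trans ih'.2⟩
  | comp _ _ ih ih' => exact ⟨ih.1, ih'.2⟩
  | tensor _ _ ih ih' => exact ⟨by rw [ih.1, ih'.1], by rw [ih.2, ih'.2]⟩

namespace PGAEq

variable {u v w x u' v' w' x' v'' w'' : List Dir}

theorem refl (c : Diagram M v w) : PGAEq c c := Congruence.refl c

theorem symm {c : Diagram M v w} {d : Diagram M v' w'} (h : PGAEq c d) : PGAEq d c :=
  Congruence.symm h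

theorem trans {c : Diagram M v w} {d : Diagram M v' w'} {e : Diagram M v'' w''}
    (h : PGAEq c d) (h' : PGAEq d e) : PGAEq c e :=
  Congruence.trans h h'

theorem comp {c : Diagram M u v} {d : Diagram M v w} {c' : Diagram M u' v'}
    {d' : Diagram M v' w'} (h : PGAEq c c') (h' : PGAEq d d') :
    PGAEq (Diagram.comp c d) (Diagram.comp c' d') :=
  Congruence.comp h h'

theorem tensor {c : Diagram M u v} {d : Diagram M w x} {c' : Diagram M u' v'}
    {d' : Diagram M w' x'} (h : PGAEq c c') (h' : PGAEq d d') :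
    PGAEq (Diagram.tensor c d) (Diagram.tensor c' d') :=
  Congruence.tensor h h'

theorem of_law {c : Diagram M v w} {d : Diagram M v' w'} (h : SMCLaw M c d) : PGAEq c d :=
  Congruence.of (Or.inl h)

theorem of_pga {c : Diagram M v w} {d : Diagram M v' w'} (h : PGAAxiom M c d) : PGAEq c d :=
  Congruence.of (Or.inr h)

/-- Since provable equality may relate diagrams of propositionally equal types, retyping is
invisible to it. All coherence isomorphisms below are retyped identities and can therefore be
erased. -/
theorem retype (c : Diagram M v w) (hv : v = v') (hw : w = w') : PGAEq (c.retype hv hw) c := by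
  subst hv hw
  exact refl c

theorem words_eq {c : Diagram M v w} {d : Diagram M v' w'} (h : PGAEq c d) :
    v = v' ∧ w = w' := by
  refine Congruence.words_eq ?_ h
  rintro _ _ _ _ _ _ (h | h) <;> cases h <;> simp

theorem id_of_eq (h : v = w) : PGAEq (Diagram.id (M := M) v) (Diagram.id (M := M) w) := by
  subst h; exact refl _

/-- A factor that is an identity up to retyping can be dropped on the right. -/
theorem comp_of_id {c : Diagram M u v} {d : Diagram M v w} {c' : Diagram M u' v'}
    (h : PGAEq c c') (h' : PGAEq d (Diagram.id x)) : PGAEq (Diagram.comp c d) c' :=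
  ((refl c).comp (h'.trans (id_of_eq h'.words_eq.1.symm))).trans ((of_law (.comp_id c)).trans h)

/-- A factor that is an identity up to retyping can be dropped on the left. -/
theorem id_of_comp {c : Diagram M u v} {d : Diagram M v w} {d' : Diagram M v' w'}
    (h : PGAEq c (Diagram.id x)) (h' : PGAEq d d') : PGAEq (Diagram.comp c d) d' :=
  ((h.trans (id_of_eq h.words_eq.2.symm)).comp (refl d)).trans ((of_law (.id_comp d)).trans h')

theorem retype_id (h : v = v') (h' : v = w') :
    PGAEq ((Diagram.id (M := M) v).retype h h') (Diagram.id v) :=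
  retype _ _ _

theorem tensor_ids {c : Diagram M v v'} {d : Diagram M w w'} (h : PGAEq c (Diagram.id x))
    (h' : PGAEq d (Diagram.id x')) : PGAEq (Diagram.tensor c d) (Diagram.id (x ++ x')) :=
  (h.tensor h').trans (of_law (.id_tensor_id x x'))

end PGAEq


/-- Words of wires, as objects of the category of diagrams modulo provable equality. -/
structure Word (M : ℕ) : Type where
  dirs : List Dir

namespace Word

/-- Provable equality of diagrams of the same type. -/
instance pgaSetoid (v w : List Dir) : Setoid (Diagram M v w) where
  r c d := PGAEq c d
  iseqv := ⟨PGAEq.refl, PGAEq.symm, PGAEq.trans⟩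

/-- Diagrams modulo provable equality. -/
abbrev Mor (v w : Word M) : Type := Quotient (pgaSetoid (M := M) v.dirs w.dirs)

instance : CategoryStruct (Word M) where
  Hom := Mor
  id v := Quotient.mk _ (Diagram.id v.dirs)
  comp := Quotient.map₂ Diagram.comp fun _ _ h _ _ h' => PGAEq.comp h h'

/-- The class of a diagram. -/
def cls {v w : Word M} (c : Diagram M v.dirs w.dirs) : v ⟶ w := Quotient.mk _ c

theorem cls_eq {v w : Word M} {c d : Diagram M v.dirs w.dirs} : cls c = cls d ↔ PGAEq c d :=
  Quotient.eq

theorem cls_surj {v w : Word M} (f : v ⟶ w) : ∃ c : Diagram M v.dirs w.dirs, cls c = f :=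
  Quotient.exists_rep f

theorem cls_comp {u v w : Word M} (c : Diagram M u.dirs v.dirs) (d : Diagram M v.dirs w.dirs) :
    cls c ≫ cls d = cls (w := w) (Diagram.comp c d) := rfl

instance : Category (Word M) where
  id_comp f := by
    obtain ⟨c, rfl⟩ := cls_surj f
    exact cls_eq.2 (.of_law (.id_comp c))
  comp_id f := by
    obtain ⟨c, rfl⟩ := cls_surj f
    exact cls_eq.2 (.of_law (.comp_id c))
  assoc f g h := by
    obtain ⟨c, rfl⟩ := cls_surj f
    obtain ⟨d, rfl⟩ := cls_surj g
    obtain ⟨e, rfl⟩ := cls_surj h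
    exact cls_eq.2 (.of_law (.comp_assoc c d e))

/-- The isomorphism between equal words. -/
def isoOfEq (v w : Word M) (h : v.dirs = w.dirs) : v ≅ w where
  hom := cls ((Diagram.id v.dirs).retype rfl h)
  inv := cls ((Diagram.id w.dirs).retype rfl h.symm)
  hom_inv_id := cls_eq.2 <| .comp_of_id (.retype _ _ _) <|
    .retype_id _ _
  inv_hom_id := cls_eq.2 <| .comp_of_id (.retype _ _ _) <|
    .retype_id _ _

instance : MonoidalCategoryStruct (Word M) where
  tensorObj v w := ⟨v.dirs ++ w.dirs⟩
  whiskerLeft v _ _ := Quotient.map (Diagram.tensor (Diagram.id v.dirs))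
    fun _ _ h => PGAEq.tensor (.refl _) h
  whiskerRight f v := Quotient.map (fun c => Diagram.tensor c (Diagram.id v.dirs))
    (fun _ _ h => PGAEq.tensor h (.refl _)) f
  tensorHom := Quotient.map₂ Diagram.tensor fun _ _ h _ _ h' => PGAEq.tensor h h'
  tensorUnit := ⟨[]⟩
  associator u v w := isoOfEq _ _ (List.append_assoc u.dirs v.dirs w.dirs)
  leftUnitor v := isoOfEq _ _ (List.nil_append v.dirs)
  rightUnitor v := isoOfEq _ _ (List.append_nil v.dirs)

end Word

namespace Word

/-- Each axiom is a law of strict monoidal categories once the coherence isomorphisms are dropped by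
`PGAEq.comp_of_id` and `PGAEq.id_of_comp`. In the pentagon and the triangle both sides are
identities up to retyping. -/
instance : MonoidalCategory (Word M) where
  tensorHom_def f g := by
    obtain ⟨c, rfl⟩ := cls_surj f
    obtain ⟨d, rfl⟩ := cls_surj g
    exact cls_eq.2 <| .trans
      (.tensor (.symm (.of_law (.comp_id c))) (.symm (.of_law (.id_comp d))))
      (.of_law (.interchange c _ _ d))
  id_tensorHom_id v w := cls_eq.2 <| .of_law (.id_tensor_id v.dirs w.dirs)
  tensorHom_comp_tensorHom f g f' g' := by
    obtain ⟨c, rfl⟩ := cls_surj f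
    obtain ⟨d, rfl⟩ := cls_surj g
    obtain ⟨c', rfl⟩ := cls_surj f'
    obtain ⟨d', rfl⟩ := cls_surj g'
    exact cls_eq.2 <| .symm <| .of_law (.interchange c c' d d')
  whiskerLeft_id v w := cls_eq.2 <| .of_law (.id_tensor_id v.dirs w.dirs)
  id_whiskerRight v w := cls_eq.2 <| .of_law (.id_tensor_id v.dirs w.dirs)
  associator_naturality f g h := by
    obtain ⟨c, rfl⟩ := cls_surj f
    obtain ⟨d, rfl⟩ := cls_surj g
    obtain ⟨e, rfl⟩ := cls_surj h
    exact cls_eq.2 <| .trans (.comp_of_id (.of_law (.tensor_assoc c d e)) (.retype_id _ _))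
      (.symm (.id_of_comp (.retype_id _ _) (.refl _)))
  leftUnitor_naturality f := by
    obtain ⟨c, rfl⟩ := cls_surj f
    exact cls_eq.2 <| .trans (.comp_of_id (.of_law (.empty_tensor c)) (.retype_id _ _))
      (.symm (.id_of_comp (.retype_id _ _) (.refl _)))
  rightUnitor_naturality f := by
    obtain ⟨c, rfl⟩ := cls_surj f
    exact cls_eq.2 <| .trans (.comp_of_id (.of_law (.tensor_empty c)) (.retype_id _ _))
      (.symm (.id_of_comp (.retype_id _ _) (.refl _)))
  pentagon u v w x := cls_eq.2 <| .trans
    (.comp_of_id (.tensor_ids (.retype_id _ _) (.refl _))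
      (PGAEq.comp_of_id (.retype_id _ _) (.tensor_ids (.refl _) (.retype_id _ _))))
    (.symm (.comp_of_id ((PGAEq.retype_id _ _).trans (.id_of_eq (by simp [tensorObj])))
      (.retype_id _ _)))
  triangle v w := cls_eq.2 <| .trans
    (.comp_of_id (.retype_id _ _) (.tensor_ids (.refl _) (.retype_id _ _)))
    (.symm (.tensor_ids (.retype_id _ _) (.refl _)))

/-- The crossing of words. -/
def crossing (v w : Word M) : v ⊗ w ≅ w ⊗ v where
  hom := cls (Diagram.swap v.dirs w.dirs)
  inv := cls (Diagram.swap w.dirs v.dirs)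
  hom_inv_id := cls_eq.2 <| .of_law (.swap_swap _ _)
  inv_hom_id := cls_eq.2 <| .of_law (.swap_swap _ _)

theorem swap_hexagon (u v w : List Dir) :
    PGAEq (Diagram.swap (M := M) u (v ++ w))
      (Diagram.comp (Diagram.tensor (Diagram.swap u v) (Diagram.id w))
        ((Diagram.tensor (Diagram.id v) (Diagram.swap u w)).retype
          (List.append_assoc v u w).symm (List.append_assoc v w u).symm)) :=
  .of_law (.swap_hexagon u v w)

theorem hexagon (u v w : Word M) :
    (α_ u v w).hom ≫ (crossing u (v ⊗ w)).hom ≫ (α_ v w u).hom =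
      ((crossing u v).hom ▷ w) ≫ (α_ v u w).hom ≫ (v ◁ (crossing u w).hom) :=
  cls_eq.2 <| .trans
    (.id_of_comp (.retype_id _ _) (.comp_of_id (swap_hexagon _ _ _) (.retype_id _ _)))
    (.comp (.refl _) ((PGAEq.retype _ _ _).trans (.symm (.id_of_comp (.retype_id _ _) (.refl _)))))

theorem crossing_natural {v w v' w' : Word M} (f : v ⟶ w) (g : v' ⟶ w') :
    (f ⊗ₘ g) ≫ (crossing w w').hom = (crossing v v').hom ≫ (g ⊗ₘ f) := by
  obtain ⟨c, rfl⟩ := cls_surj f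
  obtain ⟨d, rfl⟩ := cls_surj g
  exact cls_eq.2 <| .of_law (.swap_natural c d)

theorem crossing_natural_right (v : Word M) {w w' : Word M} (f : w ⟶ w') :
    v ◁ f ≫ (crossing v w').hom = (crossing v w).hom ≫ f ▷ v := by
  rw [← id_tensorHom, ← tensorHom_id, crossing_natural]

theorem crossing_natural_left {v v' : Word M} (f : v ⟶ v') (w : Word M) :
    f ▷ w ≫ (crossing v' w).hom = (crossing v w).hom ≫ w ◁ f := by
  rw [← id_tensorHom, ← tensorHom_id, crossing_natural]

/-- This is the inverse of the first hexagon for `w`, `u`, `v`, because the inverse of a crossing is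
the opposite crossing. -/
theorem hexagon_inv (u v w : Word M) :
    (α_ u v w).inv ≫ (crossing (u ⊗ v) w).hom ≫ (α_ w u v).inv =
      (u ◁ (crossing v w).hom) ≫ (α_ u w v).inv ≫ ((crossing u w).hom ▷ v) := by
  have h : α_ w u v ≪≫ (crossing w (u ⊗ v) ≪≫ α_ u v w) =
      whiskerRightIso (crossing w u) v ≪≫ (α_ u w v ≪≫ whiskerLeftIso u (crossing w v)) := by
    ext
    exact hexagon w u v
  have h := congrArg Iso.inv h
  simp only [Iso.trans_inv, whiskerRightIso_inv, whiskerLeftIso_inv, Category.assoc] at h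
  exact h

instance : BraidedCategory (Word M) where
  braiding := crossing
  braiding_naturality_right := crossing_natural_right
  braiding_naturality_left := crossing_natural_left
  hexagon_forward := hexagon
  hexagon_reverse := hexagon_inv

instance : SymmetricCategory (Word M) where
  symmetry v w := (crossing v w).hom_inv_id

end Word

end Word

/-! ### Convolution and copairing for monoid objects -/

section Convolution

open scoped MonObj

variable {C : Type*} [Category C] [MonoidalCategory C]
variable {X K : C} [MonObj K]

/-- The convolution of two morphisms. -/
def conv (δ : X ⟶ X ⊗ X) (x y : X ⟶ K) : X ⟶ K := δ ≫ (x ⊗ₘ y) ≫ μ[K]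

theorem conv_conv_left (δ δ' : X ⟶ X ⊗ X) (x y z : X ⟶ K) :
    conv δ (conv δ' x y) z = δ ≫ δ' ▷ X ≫ ((x ⊗ₘ y) ⊗ₘ z) ≫ μ[K] ▷ K ≫ μ[K] := by
  unfold conv
  rw [← tensorHom_id, ← tensorHom_id, tensorHom_comp_tensorHom_assoc,
    tensorHom_comp_tensorHom_assoc, Category.comp_id, Category.id_comp, Category.assoc]

theorem conv_conv_right (δ δ' : X ⟶ X ⊗ X) (x y z : X ⟶ K) :
    conv δ x (conv δ' y z) = δ ≫ X ◁ δ' ≫ (x ⊗ₘ (y ⊗ₘ z)) ≫ K ◁ μ[K] ≫ μ[K] := by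
  unfold conv
  rw [← id_tensorHom, ← id_tensorHom, tensorHom_comp_tensorHom_assoc,
    tensorHom_comp_tensorHom_assoc, Category.comp_id, Category.id_comp, Category.assoc]

theorem conv_unit_left (δ : X ⟶ X ⊗ X) (ε : X ⟶ 𝟙_ C) (z : X ⟶ K) :
    conv δ (ε ≫ η[K]) z = δ ≫ ε ▷ X ≫ (λ_ X).hom ≫ z := by
  unfold conv
  rw [tensorHom_def', comp_whiskerRight, Category.assoc, Category.assoc, MonObj.one_mul,
    whisker_exchange_assoc, leftUnitor_naturality]

theorem isMonHom_one : IsMonHom η[K] where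
  one_hom := by simp
  mul_hom := by simp [unitors_equal]

theorem isMonHom_unit [MonObj X] {ε : X ⟶ 𝟙_ C} (h : IsMonHom ε) : IsMonHom (ε ≫ η[K]) := by
  have := isMonHom_one (K := K)
  infer_instance

/-- The copairing of two morphisms to a monoid object. -/
def copairTwo {Y Z : C} (f : Y ⟶ K) (g : Z ⟶ K) : Y ⊗ Z ⟶ K := (f ⊗ₘ g) ≫ μ[K]

section CopairTwo

variable {Y Z W Y' Z' : C}

theorem tensor_comp_copairTwo (a : Y ⟶ Y') (b : Z ⟶ Z') (f : Y' ⟶ K) (g : Z' ⟶ K) :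
    (a ⊗ₘ b) ≫ copairTwo f g = copairTwo (a ≫ f) (b ≫ g) := by
  simp only [copairTwo, tensorHom_comp_tensorHom_assoc]

theorem copairTwo_one (f : Y ⟶ K) : copairTwo f η[K] = (ρ_ Y).hom ≫ f :=
  MonObj.mul_one_hom f

theorem one_copairTwo (f : Y ⟶ K) : copairTwo η[K] f = (λ_ Y).hom ≫ f :=
  MonObj.one_mul_hom f

theorem copairTwo_assoc (f : Y ⟶ K) (g : Z ⟶ K) (h : W ⟶ K) :
    (α_ Y Z W).hom ≫ copairTwo f (copairTwo g h) = copairTwo (copairTwo f g) h := by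
  have e₁ : (f ⊗ₘ copairTwo g h) = (f ⊗ₘ (g ⊗ₘ h)) ≫ K ◁ μ[K] := by
    rw [← id_tensorHom, tensorHom_comp_tensorHom, Category.comp_id, copairTwo]
  have e₂ : (copairTwo f g ⊗ₘ h) = ((f ⊗ₘ g) ⊗ₘ h) ≫ μ[K] ▷ K := by
    rw [← tensorHom_id, tensorHom_comp_tensorHom, Category.comp_id, copairTwo]
  rw [copairTwo, e₁, copairTwo, e₂, Category.assoc, Category.assoc, MonObj.mul_assoc,
    ← associator_naturality_assoc]

theorem copairTwo_comp {K' : C} [MonObj K'] (f : Y ⟶ K) (g : Z ⟶ K) (h : K ⟶ K') [IsMonHom h] :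
    copairTwo f g ≫ h = copairTwo (f ≫ h) (g ≫ h) := by
  rw [copairTwo, Category.assoc, IsMonHom.mul_hom, tensorHom_comp_tensorHom_assoc, copairTwo]

theorem braiding_comp_copairTwo [SymmetricCategory C] [IsCommMonObj K] (f : Y ⟶ K) (g : Z ⟶ K) :
    (β_ Z Y).hom ≫ copairTwo f g = copairTwo g f := by
  rw [copairTwo, ← BraidedCategory.braiding_naturality_assoc, IsCommMonObj.mul_comm, copairTwo]

variable [SymmetricCategory C]

theorem tensorμ_unit : tensorμ Y (𝟙_ C) (𝟙_ C) Z = 𝟙 _ := by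
  simp only [tensorμ, braiding_tensorUnit_left]
  monoidal

variable [MonObj Y] [MonObj Z]
variable (Y Z) in
/-- The first coprojection to a tensor product of monoid objects. -/
def monInl : Y ⟶ Y ⊗ Z := (ρ_ Y).inv ≫ (𝟙 Y ⊗ₘ η[Z])

variable (Y Z) in
/-- The second coprojection to a tensor product of monoid objects. -/
def monInr : Z ⟶ Y ⊗ Z := (λ_ Z).inv ≫ (η[Y] ⊗ₘ 𝟙 Z)

theorem isMonHom_monInl : IsMonHom (monInl Y Z) := by
  have := isMonHom_one (K := Z)
  unfold monInl
  infer_instance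

theorem isMonHom_monInr : IsMonHom (monInr Y Z) := by
  have := isMonHom_one (K := Y)
  unfold monInr
  infer_instance

/-- Multiplication in `Y ⊗ Z` is componentwise, and in each component one of the two factors is a
unit. This is the part of the universal property of a coproduct of commutative monoids that recovers
a morphism from its components. -/
theorem copairTwo_monInl_monInr : copairTwo (monInl Y Z) (monInr Y Z) = 𝟙 (Y ⊗ Z) := by
  rw [monInl, monInr, ← tensor_comp_copairTwo, copairTwo, MonObj.tensorObj.mul_def,
    tensorμ_natural_assoc, tensorHom_comp_tensorHom, MonObj.one_mul_hom, MonObj.mul_one_hom,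
    tensorμ_unit, Category.id_comp, tensorHom_comp_tensorHom]
  simp
end CopairTwo

variable [SymmetricCategory C] [MonObj X]

/-- A cocommutative comonoid structure by homomorphisms of monoids. -/
structure IsChoice (δ : X ⟶ X ⊗ X) (ε : X ⟶ 𝟙_ C) : Prop where
  isMonHom_comul : IsMonHom δ
  isMonHom_counit : IsMonHom ε
  assoc : δ ≫ X ◁ δ = δ ≫ δ ▷ X ≫ (α_ X X X).hom
  comm : δ ≫ (β_ X X).hom = δ
  counit : δ ≫ ε ▷ X = (λ_ X).inv

/-- The comonoid `δ` distributes over the comonoid `δ'`. -/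
structure Distributes (δ δ' : X ⟶ X ⊗ X) (ε' : X ⟶ 𝟙_ C) : Prop where
  comul : δ ≫ δ' ▷ X = δ' ≫ (δ ⊗ₘ δ) ≫ tensorμ X X X X ≫ (X ⊗ X) ◁ μ[X]
  counit : δ ≫ ε' ▷ X = ε' ≫ η[X] ≫ (λ_ X).inv

/-- Commutativity is what makes the multiplication itself a homomorphism. Through this lemma,
convolutions of homomorphisms are again homomorphisms. -/
theorem isMonHom_mul [IsCommMonObj K] : IsMonHom μ[K] where
  one_hom := by simp [MonObj.tensorObj.one_def, ← unitors_equal]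
  mul_hom := by simp [MonObj.tensorObj.mul_def]

theorem isMonHom_conv [IsCommMonObj K] {δ : X ⟶ X ⊗ X} (h : IsMonHom δ) {x y : X ⟶ K}
    (hx : IsMonHom x) (hy : IsMonHom y) : IsMonHom (conv δ x y) := by
  have := isMonHom_mul (K := K)
  unfold conv
  infer_instance

theorem IsChoice.conv_assoc {δ : X ⟶ X ⊗ X} {ε : X ⟶ 𝟙_ C} (h : IsChoice δ ε) (x y z : X ⟶ K) :
    conv δ (conv δ x y) z = conv δ x (conv δ y z) := by
  have h' := h.assoc
  rw [conv_conv_left, conv_conv_right, reassoc_of% h', ← associator_naturality_assoc,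
    MonObj.mul_assoc]

theorem IsChoice.conv_comm [IsCommMonObj K] {δ : X ⟶ X ⊗ X} {ε : X ⟶ 𝟙_ C} (h : IsChoice δ ε)
    (x y : X ⟶ K) : conv δ x y = conv δ y x := by
  unfold conv
  conv_lhs => rw [← h.comm]
  rw [Category.assoc, ← BraidedCategory.braiding_naturality_assoc, IsCommMonObj.mul_comm]

theorem IsChoice.unit_conv {δ : X ⟶ X ⊗ X} {ε : X ⟶ 𝟙_ C} (h : IsChoice δ ε) (x : X ⟶ K) :
    conv δ (ε ≫ η[K]) x = x := by
  have h' := h.counit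
  rw [conv_unit_left, reassoc_of% h']
  simp

/-- The distributivity equation for `δ` and `δ'` has two wires for `z` on its right-hand side,
joined by `μ[X]` into one. Because `z` is a homomorphism, that merge can be moved behind it, which
yields the two copies of `z`. Commutativity of `K` then regroups the four factors. -/
theorem Distributes.conv_conv [IsCommMonObj K] {δ δ' : X ⟶ X ⊗ X} {ε' : X ⟶ 𝟙_ C}
    (h : Distributes δ δ' ε') (x y z : X ⟶ K) [IsMonHom z] :
    conv δ (conv δ' x y) z = conv δ' (conv δ x z) (conv δ y z) := by
  have h' := h.comul
  have hr : conv δ' (conv δ x z) (conv δ y z) =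
      δ' ≫ (δ ⊗ₘ δ) ≫ ((x ⊗ₘ z) ⊗ₘ (y ⊗ₘ z)) ≫ (μ[K] ⊗ₘ μ[K]) ≫ μ[K] := by
    simp only [conv, tensorHom_comp_tensorHom_assoc]
  rw [hr, conv_conv_left, reassoc_of% h', ← id_tensorHom, tensorHom_comp_tensorHom_assoc,
    IsMonHom.mul_hom, Category.id_comp, ← MonObj.mul_mul_mul_comm, tensorμ_natural_assoc,
    ← tensorHom_id, tensorHom_comp_tensorHom_assoc]
  rw [tensorHom_comp_tensorHom_assoc, Category.comp_id]

/-- The equation feeds a unit into `z`, and a homomorphism sends the unit to the unit. -/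
theorem Distributes.conv_unit {δ δ' : X ⟶ X ⊗ X} {ε' : X ⟶ 𝟙_ C}
    (h : Distributes δ δ' ε') (z : X ⟶ K) [IsMonHom z] :
    conv δ (ε' ≫ η[K]) z = ε' ≫ η[K] := by
  have h' := h.counit
  rw [conv_unit_left, reassoc_of% h']
  simp

variable (X) in
/-- Operations of a bounded distributive lattice with an action of the priorities, in the opposite
of the category of monoids: they turn the homomorphisms from `X` to a commutative monoid into such
a lattice. -/
class LatticeObj (M : outParam ℕ) where
  join : X ⟶ X ⊗ X
  bot : X ⟶ 𝟙_ C
  meet : X ⟶ X ⊗ X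
  top : X ⟶ 𝟙_ C
  prio : Priority M → (X ⟶ X)
  join_isChoice : IsChoice join bot
  meet_isChoice : IsChoice meet top
  join_meet : Distributes join meet top
  meet_join : Distributes meet join bot
  isMonHom_prio (k : Priority M) : IsMonHom (prio k)
  prio_prio (k l : Priority M) : prio k ≫ prio l = prio (max k l)
  prio_zero : prio 0 = 𝟙 X
  prio_join (k : Priority M) : prio k ≫ join = join ≫ (prio k ⊗ₘ prio k)
  prio_bot (k : Priority M) : prio k ≫ bot = bot
  prio_meet (k : Priority M) : prio k ≫ meet = meet ≫ (prio k ⊗ₘ prio k)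
  prio_top (k : Priority M) : prio k ≫ top = top

variable (X K) in
/-- Homomorphisms of monoid objects. -/
@[ext]
structure MonHom where
  hom : X ⟶ K
  isMonHom : IsMonHom hom

end Convolution

/-- A bounded distributive lattice with an action of the priorities by endomorphisms. -/
class PriorityLattice (M : ℕ) (L : Type*) extends DistribLattice L, BoundedOrder L where
  act : Priority M → L → L
  act_act (k l : Priority M) (a : L) : act k (act l a) = act (max k l) a
  act_zero (a : L) : act 0 a = a
  act_sup (k : Priority M) (a b : L) : act k (a ⊔ b) = act k a ⊔ act k b
  act_bot (k : Priority M) : act k ⊥ = ⊥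
  act_inf (k : Priority M) (a b : L) : act k (a ⊓ b) = act k a ⊓ act k b
  act_top (k : Priority M) : act k ⊤ = ⊤

/-! ### The distributive lattice of monoid homomorphisms -/

namespace MonHom

open scoped MonObj

variable {M : ℕ} {C : Type*} [Category C] [MonoidalCategory C] [SymmetricCategory C]
variable {X K : C} [MonObj X] [MonObj K] [IsCommMonObj K] [LatticeObj X M]

open LatticeObj

instance : Max (MonHom X K) where
  max x y := ⟨conv join x.hom y.hom, isMonHom_conv join_isChoice.isMonHom_comul x.isMonHom y.isMonHom⟩

instance : Min (MonHom X K) where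
  min x y := ⟨conv meet x.hom y.hom, isMonHom_conv meet_isChoice.isMonHom_comul x.isMonHom y.isMonHom⟩

instance : Top (MonHom X K) where
  top := ⟨top ≫ η[K], isMonHom_unit meet_isChoice.isMonHom_counit⟩

instance : Bot (MonHom X K) where
  bot := ⟨bot ≫ η[K], isMonHom_unit join_isChoice.isMonHom_counit⟩

variable (x y z : MonHom X K)

theorem sup_comm' : x ⊔ y = y ⊔ x := MonHom.ext (join_isChoice.conv_comm _ _)
theorem inf_comm' : x ⊓ y = y ⊓ x := MonHom.ext (meet_isChoice.conv_comm _ _)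
theorem sup_assoc' : x ⊔ y ⊔ z = x ⊔ (y ⊔ z) := MonHom.ext (join_isChoice.conv_assoc _ _ _)
theorem inf_assoc' : x ⊓ y ⊓ z = x ⊓ (y ⊓ z) := MonHom.ext (meet_isChoice.conv_assoc _ _ _)
theorem bot_sup : ⊥ ⊔ x = x := MonHom.ext (join_isChoice.unit_conv _)
theorem top_inf : ⊤ ⊓ x = x := MonHom.ext (meet_isChoice.unit_conv _)

theorem inf_sup : (x ⊓ y) ⊔ z = (x ⊔ z) ⊓ (y ⊔ z) :=
  have := z.isMonHom
  MonHom.ext (join_meet.conv_conv _ _ _)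

theorem sup_inf : (x ⊔ y) ⊓ z = (x ⊓ z) ⊔ (y ⊓ z) :=
  have := z.isMonHom
  MonHom.ext (meet_join.conv_conv _ _ _)

theorem top_sup : ⊤ ⊔ x = ⊤ :=
  have := x.isMonHom
  MonHom.ext (join_meet.conv_unit _)

theorem bot_inf : ⊥ ⊓ x = ⊥ :=
  have := x.isMonHom
  MonHom.ext (meet_join.conv_unit _)

/-- Absorption follows from distributivity and the law `⊤ ⊔ y = ⊤`, by writing the first `x` as `⊤ ⊓
x`. Idempotence is not an input of `Lattice.mk'`, as it follows from the two absorption laws. -/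
theorem sup_inf_self' : x ⊔ x ⊓ y = x := by
  have h : x ⊔ x ⊓ y = (⊤ ⊓ x) ⊔ (y ⊓ x) := by rw [top_inf, inf_comm' x y]
  rw [h, ← sup_inf, top_sup, top_inf]

theorem inf_sup_self' : x ⊓ (x ⊔ y) = x := by
  have h : x ⊓ (x ⊔ y) = (⊥ ⊔ x) ⊓ (y ⊔ x) := by rw [bot_sup, sup_comm' x y]
  rw [h, ← inf_sup, bot_inf, bot_sup]

instance : Lattice (MonHom X K) :=
  Lattice.mk' sup_comm' sup_assoc' inf_comm' inf_assoc' sup_inf_self' inf_sup_self'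

instance : PriorityLattice M (MonHom X K) where
  __ := DistribLattice.ofInfSupLe fun x y z : MonHom X K => by
    rw [inf_comm, sup_inf, inf_comm y, inf_comm z]
  le_top x := sup_eq_left.1 (top_sup x)
  bot_le x := sup_eq_right.1 (bot_sup x)
  act k x := ⟨prio k ≫ x.hom, have := x.isMonHom; have := isMonHom_prio (X := X) k; inferInstance⟩
  act_act k l x := MonHom.ext (by
    change prio k ≫ prio l ≫ x.hom = _
    rw [← Category.assoc, prio_prio])
  act_zero x := MonHom.ext (by
    change prio 0 ≫ x.hom = _
    rw [prio_zero, Category.id_comp])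
  act_sup k x y := MonHom.ext (by
    change prio k ≫ join ≫ (x.hom ⊗ₘ y.hom) ≫ μ[K] =
      join ≫ ((prio k ≫ x.hom) ⊗ₘ (prio k ≫ y.hom)) ≫ μ[K]
    rw [← Category.assoc, prio_join, Category.assoc, tensorHom_comp_tensorHom_assoc])
  act_inf k x y := MonHom.ext (by
    change prio k ≫ meet ≫ (x.hom ⊗ₘ y.hom) ≫ μ[K] =
      meet ≫ ((prio k ≫ x.hom) ⊗ₘ (prio k ≫ y.hom)) ≫ μ[K]
    rw [← Category.assoc, prio_meet, Category.assoc, tensorHom_comp_tensorHom_assoc])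
  act_bot k := MonHom.ext (by
    change prio k ≫ bot ≫ η[K] = bot ≫ η[K]
    rw [← Category.assoc, prio_bot])
  act_top k := MonHom.ext (by
    change prio k ≫ top ≫ η[K] = top ≫ η[K]
    rw [← Category.assoc, prio_top])

end MonHom

/-! ### The wire as a lattice object -/

namespace Word

variable {M : ℕ}

variable (M) in
/-- The wire directed to the right. -/
def wire : Word M := ⟨[.right]⟩

/-- The interchange of the two middle factors is assembled from associators, so its representative
is not literally `1 ⊗ σ ⊗ 1`. What is needed below is only some representative that is provably
equal to it. -/
theorem cls_tensorμ (u v w x : Word M) :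
    ∃ e, tensorμ u v w x = cls (M := M) e ∧ PGAEq e
      (Diagram.tensor (Diagram.tensor (Diagram.id u.dirs) (Diagram.swap v.dirs w.dirs))
        (Diagram.id x.dirs)) :=
  ⟨_, rfl, .id_of_comp (.retype_id _ _) (.id_of_comp (.tensor_ids (.refl _) (.retype_id _ _))
    (.trans (.comp_of_id (.refl _) (.comp_of_id (.tensor_ids (.refl _) (.retype_id _ _))
      (.retype_id _ _))) (.symm (.of_law (.tensor_assoc _ _ _)))))⟩

instance : MonObj (wire M) where
  one := cls (v := 𝟙_ (Word M)) (w := wire M) Diagram.start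
  mul := cls (v := wire M ⊗ wire M) (w := wire M) Diagram.merge
  one_mul := cls_eq.2 (.trans (.of_pga .B3l) (.symm (.retype_id _ _)))
  mul_one := cls_eq.2 (.trans (.of_pga .B3r) (.symm (.retype_id _ _)))
  mul_assoc := cls_eq.2 (.trans (.symm (.of_pga .B1))
    (.symm (.id_of_comp (.retype_id _ _) (.refl _))))

instance : IsCommMonObj (wire M) where
  mul_comm := cls_eq.2 (.of_pga .B2)

theorem isMonHom_player0 : IsMonHom (M := wire M) (N := wire M ⊗ wire M)
    (cls Diagram.player0) where
  one_hom := cls_eq.2 (.trans (.of_pga .B12) (.symm (.id_of_comp (.retype_id _ _) (.refl _))))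
  mul_hom := by
    obtain ⟨e, he, h⟩ := cls_tensorμ (wire M) (wire M) (wire M) (wire M)
    change _ = _ ≫ tensorμ _ _ _ _ ≫ _
    rw [he]
    exact cls_eq.2 (.trans (.of_pga .B10) (.comp (.refl _) (.comp (.symm h) (.refl _))))

theorem isChoice_player0 : IsChoice (X := wire M)
    (cls (v := wire M) (w := wire M ⊗ wire M) Diagram.player0)
    (cls (v := wire M) (w := 𝟙_ (Word M)) Diagram.lose0) where
  isMonHom_comul := isMonHom_player0
  isMonHom_counit := {
    one_hom := cls_eq.2 (.of_pga .B14)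
    mul_hom := cls_eq.2
      (.trans (.of_pga .B11) (.symm (.comp_of_id (.refl _) (.retype_id _ _)))) }
  assoc := cls_eq.2 (.trans (.symm (.of_pga .B4))
    (.comp (.refl _) (.symm (.comp_of_id (.refl _) (.retype_id _ _)))))
  comm := cls_eq.2 (.of_pga .B5)
  counit := cls_eq.2 (.trans (.of_pga .B6r) (.symm (.retype_id _ _)))

theorem isMonHom_player1 : IsMonHom (M := wire M) (N := wire M ⊗ wire M)
    (cls Diagram.player1) where
  one_hom := cls_eq.2 (.trans (.of_pga .B13) (.symm (.id_of_comp (.retype_id _ _) (.refl _))))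
  mul_hom := by
    obtain ⟨e, he, h⟩ := cls_tensorμ (wire M) (wire M) (wire M) (wire M)
    change _ = _ ≫ tensorμ _ _ _ _ ≫ _
    rw [he]
    exact cls_eq.2 (.trans (.of_pga .B18) (.comp (.refl _) (.comp (.symm h) (.refl _))))

theorem isChoice_player1 : IsChoice (X := wire M)
    (cls (v := wire M) (w := wire M ⊗ wire M) Diagram.player1)
    (cls (v := wire M) (w := 𝟙_ (Word M)) Diagram.lose1) where
  isMonHom_comul := isMonHom_player1
  isMonHom_counit := {
    one_hom := cls_eq.2 (.of_pga .B15)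
    mul_hom := cls_eq.2
      (.trans (.of_pga .B19) (.symm (.comp_of_id (.refl _) (.retype_id _ _)))) }
  assoc := cls_eq.2 (.trans (.symm (.of_pga .B7))
    (.comp (.refl _) (.symm (.comp_of_id (.refl _) (.retype_id _ _)))))
  comm := cls_eq.2 (.of_pga .B8)
  counit := cls_eq.2 (.trans (.of_pga .B9r) (.symm (.retype_id _ _)))

theorem distributes_player0_player1 : Distributes (X := wire M)
    (cls (v := wire M) (w := wire M ⊗ wire M) Diagram.player0)
    (cls (v := wire M) (w := wire M ⊗ wire M) Diagram.player1)
    (cls (v := wire M) (w := 𝟙_ (Word M)) Diagram.lose1) where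
  comul := by
    obtain ⟨e, he, h⟩ := cls_tensorμ (wire M) (wire M) (wire M) (wire M)
    rw [he]
    exact cls_eq.2 (.trans (.of_pga .B20)
      (.comp (.refl _) (.comp (.refl _) (.comp (.symm h) (.refl _)))))
  counit := cls_eq.2 (.trans (.of_pga .B21)
    (.comp (.refl _) (.symm (.comp_of_id (.refl _) (.retype_id _ _)))))

theorem distributes_player1_player0 : Distributes (X := wire M)
    (cls (v := wire M) (w := wire M ⊗ wire M) Diagram.player1)
    (cls (v := wire M) (w := wire M ⊗ wire M) Diagram.player0)
    (cls (v := wire M) (w := 𝟙_ (Word M)) Diagram.lose0) where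
  comul := by
    obtain ⟨e, he, h⟩ := cls_tensorμ (wire M) (wire M) (wire M) (wire M)
    rw [he]
    exact cls_eq.2 (.trans (.of_pga .B22)
      (.comp (.refl _) (.comp (.refl _) (.comp (.symm h) (.refl _)))))
  counit := cls_eq.2 (.trans (.of_pga .B23)
    (.comp (.refl _) (.symm (.comp_of_id (.refl _) (.retype_id _ _)))))

instance : LatticeObj (wire M) M where
  join := cls (v := wire M) (w := wire M ⊗ wire M) Diagram.player0
  bot := cls (v := wire M) (w := 𝟙_ (Word M)) Diagram.lose0
  meet := cls (v := wire M) (w := wire M ⊗ wire M) Diagram.player1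
  top := cls (v := wire M) (w := 𝟙_ (Word M)) Diagram.lose1
  prio k := cls (v := wire M) (w := wire M) (Diagram.prio k)
  join_isChoice := isChoice_player0
  meet_isChoice := isChoice_player1
  join_meet := distributes_player0_player1
  meet_join := distributes_player1_player0
  isMonHom_prio k := {
    one_hom := cls_eq.2 (.of_pga (.C2 k))
    mul_hom := cls_eq.2 (.symm (.of_pga (.C1 k))) }
  prio_prio k l := cls_eq.2 (.of_pga (.C3 k l))
  prio_zero := cls_eq.2 (.of_pga .C4)
  prio_join k := cls_eq.2 (.of_pga (.D1 k))
  prio_bot k := cls_eq.2 (.of_pga (.D2 k))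
  prio_meet k := cls_eq.2 (.of_pga (.D3 k))
  prio_top k := cls_eq.2 (.of_pga (.D4 k))

end Word

/-! ### Interpretation of diagrams in lattices with priorities -/

section Interpretation

variable {M : ℕ} {L L' : Type*} [PriorityLattice M L] [PriorityLattice M L']

/-- The interpretation of a generator, which maps values of the wires of its target to values of
the wires of its source. -/
def Gen.interp : ∀ {v w : List Dir}, Gen M v w → (ℕ → L) → ℕ → L
  | _, _, player0, x, _ => x 0 ⊔ x 1
  | _, _, lose0, _, _ => ⊥
  | _, _, player1, x, _ => x 0 ⊓ x 1
  | _, _, lose1, _, _ => ⊤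
  | _, _, merge, x, _ => x 0
  -- A default value, here and for `cap` and `cup`: `start` has no wire in its source, and acyclic
  -- diagrams contain neither caps nor cups.
  | _, _, start, _, _ => ⊥
  | _, _, prio p, x, _ => PriorityLattice.act p (x 0)
  | _, _, cap, _, _ => ⊥
  | _, _, cup, _, _ => ⊥

/-- The interpretation of a diagram (without caps and cups), which maps values of the wires of its
target to values of the wires of its source. -/
def Diagram.interp : ∀ {v w : List Dir}, Diagram M v w → (ℕ → L) → ℕ → L
  | _, _, gen g, x, i => g.interp x i
  | _, _, id _, x, i => x i
  | _, _, swap v w, x, i => if i < v.length then x (w.length + i) else x (i - v.length)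
  | _, _, comp c d, x, i => c.interp (d.interp x) i
  | _, _, tensor (v := v) (w := w) c d, x, i =>
    if i < v.length then c.interp x i else d.interp (fun j => x (w.length + j)) (i - v.length)

/-- The interpretation of diagrams commutes with homomorphisms. -/
theorem Diagram.map_interp (f : L → L') (hsup : ∀ a b, f (a ⊔ b) = f a ⊔ f b)
    (hinf : ∀ a b, f (a ⊓ b) = f a ⊓ f b) (hbot : f ⊥ = ⊥) (htop : f ⊤ = ⊤)
    (hact : ∀ (k : Priority M) a, f (PriorityLattice.act k a) = PriorityLattice.act k (f a))
    {v w : List Dir} (c : Diagram M v w) (x : ℕ → L) (i : ℕ) :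
    f (c.interp x i) = c.interp (fun j => f (x j)) i := by
  induction c generalizing x i with
  | gen g => cases g <;> simp [interp, Gen.interp, *]
  | id v => rfl
  | swap v w => simp only [interp]; split <;> rfl
  | comp c d ihc ihd => simp only [interp, ihc]; congr 1; funext j; exact ihd _ _
  | tensor c d ihc ihd =>
    simp only [interp]
    split
    · exact ihc _ _
    · exact ihd _ _

end Interpretation

section AllRight

/-- All the wires of a word are directed to the right. -/
def AllRight (v : List Dir) : Prop := ∀ a ∈ v, a = Dir.right

theorem AllRight.tail {a : Dir} {v : List Dir} (h : AllRight (a :: v)) : AllRight v :=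
  fun b hb => h b (List.mem_cons_of_mem a hb)

theorem allRight_append {v w : List Dir} : AllRight (v ++ w) ↔ AllRight v ∧ AllRight w := by
  simp only [AllRight, List.mem_append]
  exact ⟨fun h => ⟨fun a ha => h a (.inl ha), fun a ha => h a (.inr ha)⟩,
    fun h a ha => ha.elim (h.1 a) (h.2 a)⟩

theorem allRight_rightWires (n : ℕ) : AllRight (rightWires n) :=
  fun _ ha => List.eq_of_mem_replicate ha

variable {M : ℕ}

/-- A left wire can only be created by a cup. This makes the hidden middle word of a composition
consist of right wires, so that inductions over diagrams can enter both factors. -/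
theorem Diagram.IsAcyclic.allRight {v w : List Dir} {c : Diagram M v w} (hc : c.IsAcyclic)
    (hv : AllRight v) : AllRight w := by
  induction c with
  | gen g =>
    rcases hc with h | h | h | h <;> cases h <;> simp [AllRight]
  | id v => exact hv
  | swap v w => exact allRight_append.2 (allRight_append.1 hv).symm
  | comp c d ihc ihd => exact ihd hc.2 (ihc hc.1 hv)
  | tensor c d ihc ihd =>
    have hv := allRight_append.1 hv
    exact allRight_append.2 ⟨ihc hc.1 hv.1, ihd hc.2 hv.2⟩

end AllRight

/-! ### Morphisms out of a word of right wires, by components -/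

namespace Word

open scoped MonObj

variable {M : ℕ} {K K' : Word M} [MonObj K] [MonObj K']

/-- The morphism out of a word given by its components. -/
def copair : ∀ (v : List Dir), AllRight v → (ℕ → MonHom (wire M) K) → ((⟨v⟩ : Word M) ⟶ K)
  | [], _, _ => η[K]
  | .right :: v, h, x => copairTwo (x 0).hom (copair v h.tail fun i => x (i + 1))
  | .left :: _, h, _ => nomatch h .left List.mem_cons_self

/-- Values are indexed by all natural numbers to avoid casts between index types; those beyond the
length of the word do not matter. -/
theorem copair_congr {v : List Dir} (h : AllRight v) {x y : ℕ → MonHom (wire M) K}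
    (hxy : ∀ i < v.length, x i = y i) : copair v h x = copair v h y := by
  induction v generalizing x y with
  | nil => rfl
  | cons a v ih =>
    cases a with
    | left => nomatch h .left List.mem_cons_self
    | right =>
      simp only [copair]
      rw [hxy 0 (by simp), ih h.tail fun i hi => hxy (i + 1) (by simpa using hi)]

theorem copair_append (v v' : List Dir) (h : AllRight v) (h' : AllRight v')
    (hvv' : AllRight (v ++ v')) (x : ℕ → MonHom (wire M) K) :
    copair (v ++ v') hvv' x =
      copairTwo (copair v h x) (copair v' h' fun i => x (v.length + i)) := by
  induction v generalizing x with
  | nil =>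
    simp only [copair, List.length_nil, Nat.zero_add]
    exact ((one_copairTwo _).trans (Category.id_comp _)).symm
  | cons a v ih =>
    cases a with
    | left => nomatch h .left List.mem_cons_self
    | right =>
      have hx : (fun i => x ((Dir.right :: v).length + i)) = fun i => x (v.length + i + 1) := by
        funext i
        congr 1
        simp only [List.length_cons]
        omega
      rw [hx]
      refine (congrArg (copairTwo (x 0).hom) (ih h.tail hvv'.tail fun i => x (i + 1))).trans ?_
      refine .trans ?_ (copairTwo_assoc (Y := wire M) (Z := ⟨v⟩) (W := ⟨v'⟩) (x 0).hom
        (copair v h.tail fun i => x (i + 1)) _)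
      exact (Category.id_comp _).symm

theorem copair_singleton (h : AllRight [.right]) (x : ℕ → MonHom (wire M) K) :
    copair [.right] h x = (x 0).hom :=
  (copairTwo_one _).trans (Category.id_comp _)

theorem copair_pair (h : AllRight [.right, .right]) (x : ℕ → MonHom (wire M) K) :
    copair [.right, .right] h x = copairTwo (x 0).hom (x 1).hom :=
  congrArg (copairTwo (x 0).hom) (copair_singleton (by simp [AllRight]) fun i => x (i + 1))

/-- The composition of homomorphisms of monoid objects. -/
def _root_.ParityGame.MonHom.comp (x : MonHom (wire M) K) (f : MonHom K K') :
    MonHom (wire M) K' :=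
  ⟨x.hom ≫ f.hom, have := x.isMonHom; have := f.isMonHom; inferInstance⟩

theorem copair_comp {v : List Dir} (h : AllRight v) (x : ℕ → MonHom (wire M) K)
    (f : MonHom K K') : copair v h x ≫ f.hom = copair v h fun i => (x i).comp f := by
  have := f.isMonHom
  induction v generalizing x with
  | nil => exact IsMonHom.one_hom f.hom
  | cons a v ih =>
    cases a with
    | left => nomatch h .left List.mem_cons_self
    | right =>
      exact (copairTwo_comp _ _ _).trans
        (congrArg (copairTwo ((x 0).hom ≫ f.hom)) (ih h.tail fun i => x (i + 1)))

/-- A diagram without caps and cups acts on components as its interpretation. -/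
theorem cls_comp_copair [IsCommMonObj K] {v w : List Dir} (c : Diagram M v w) (hc : c.IsAcyclic)
    (hv : AllRight v) (hw : AllRight w) (x : ℕ → MonHom (wire M) K) :
    cls (v := ⟨v⟩) (w := ⟨w⟩) c ≫ copair w hw x = copair v hv (c.interp x) := by
  induction c generalizing x with
  | gen g =>
    cases g with
    | player0 => rw [copair_pair, copair_singleton]; rfl
    | lose0 => rw [copair_singleton]; rfl
    | player1 => rw [copair_pair, copair_singleton]; rfl
    | lose1 => rw [copair_singleton]; rfl
    | merge =>
      -- Merging and then applying `x 0` is the copairing of `x 0` with itself: this is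
      -- multiplicativity of `x 0`. The case of `start` is its preservation of the unit.
      have := (x 0).isMonHom
      rw [copair_pair, copair_singleton]
      exact IsMonHom.mul_hom (x 0).hom
    | start =>
      have := (x 0).isMonHom
      rw [copair_singleton]
      exact IsMonHom.one_hom (x 0).hom
    | prio p => rw [copair_singleton, copair_singleton]; rfl
    | cap => rcases hc with h | h | h | h <;> cases h
    | cup => rcases hc with h | h | h | h <;> cases h
  | id v => exact Category.id_comp _
  | swap v w =>
    obtain ⟨hv', hw'⟩ := allRight_append.1 hv
    rw [copair_append v w hv' hw', copair_append w v hw' hv']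
    -- A crossing exchanges the two halves of a copairing because `K` is commutative.
    refine (braiding_comp_copairTwo _ _).trans ?_
    congr 1
    · exact copair_congr hv' fun i hi => by simp only [Diagram.interp, if_pos hi]
    · exact copair_congr hw' fun i hi => by simp [Diagram.interp]
  | comp c d ihc ihd =>
    have := Diagram.IsAcyclic.allRight hc.1 hv
    rw [← cls_comp (u := ⟨_⟩) (v := ⟨_⟩) (w := ⟨_⟩), Category.assoc, ihd hc.2 this,
      ihc hc.1 hv this]
    rfl
  | @tensor v w v' w' c d ihc ihd =>
    obtain ⟨hv₁, hv₂⟩ := allRight_append.1 hv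
    obtain ⟨hw₁, hw₂⟩ := allRight_append.1 hw
    rw [copair_append v v' hv₁ hv₂, copair_append w w' hw₁ hw₂]
    refine (tensor_comp_copairTwo (cls (v := ⟨v⟩) (w := ⟨w⟩) c) (cls (v := ⟨v'⟩) (w := ⟨w'⟩) d)
      _ _).trans ?_
    rw [ihc hc.1 hv₁ hw₁, ihd hc.2 hv₂ hw₂]
    congr 1
    · exact copair_congr hv₁ fun i hi => by simp only [Diagram.interp, if_pos hi]
    · exact copair_congr hv₂ fun i hi => by simp [Diagram.interp]

end Word

/-! ### Separation by prime ideals -/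

section Separation

variable {M : ℕ}

/-- The argument of a function stands for the greatest priority seen so far, and meeting the
priority `k` updates it to the maximum. -/
instance : PriorityLattice M (Priority M → Prop) where
  act k f l := f (max l k)
  act_act k l f := by funext j; simp only [max_assoc]
  act_zero f := by funext j; simp
  act_sup _ _ _ := rfl
  act_bot _ := rfl
  act_inf _ _ _ := rfl
  act_top _ := rfl

/-- Two diagrams with the same interpretation in the functions from priorities to truth values have
the same interpretation everywhere. -/
theorem Diagram.interp_eq_of_prop {u w u' w' : List Dir} {c : Diagram M u w}
    {d : Diagram M u' w'} {i : ℕ}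
    (h : ∀ T : ℕ → Priority M → Prop, c.interp T i 0 ↔ d.interp T i 0)
    {L : Type*} [PriorityLattice M L] (x : ℕ → L) : c.interp x i = d.interp x i := by
  -- If `a ≤ b` fails, the filter above `a` and the ideal below `b` are disjoint, and the prime
  -- ideal theorem provides an ideal that contains `b` but not `a`.
  have key : ∀ a b : L, (∀ J : Order.Ideal L, J.IsPrime → b ∈ J → a ∈ J) → a ≤ b := by
    intro a b hab
    by_contra hle
    have hdisj : Disjoint (Order.PFilter.principal a : Set L) (Order.Ideal.principal b : Set L) := by
      rw [Set.disjoint_left]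
      intro y hy hy'
      exact hle ((Order.PFilter.mem_principal.1 hy).trans (Order.Ideal.mem_principal.1 hy'))
    obtain ⟨J, hJ, hbJ, haJ⟩ := DistribLattice.prime_ideal_of_disjoint_filter_ideal hdisj
    exact Set.disjoint_left.1 haJ (Order.PFilter.mem_principal.2 le_rfl)
      (hab J hJ (hbJ (Order.Ideal.mem_principal.2 le_rfl)))
  have hmem : ∀ J : Order.Ideal L, J.IsPrime → (c.interp x i ∉ J ↔ d.interp x i ∉ J) := by
    intro J hJ
    -- The complement of a prime ideal is a homomorphism to truth values, but it need not respect
    -- the priorities. Recording it after every action `act k` makes it equivariant, and the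
    -- component at `0` gives back the complement.
    let f : L → Priority M → Prop := fun a k => PriorityLattice.act k a ∉ J
    have hf {v v' : List Dir} (e : Diagram M v v') :
        e.interp x i ∉ J ↔ e.interp (fun j => f (x j)) i 0 := by
      rw [← Diagram.map_interp f _ _ _ _ _ e x i]
      · simp only [f, PriorityLattice.act_zero]
      · intro a b
        funext k
        simp only [f, PriorityLattice.act_sup, Order.Ideal.sup_mem_iff, Pi.sup_apply, sup_Prop_eq,
          not_and_or]
      · intro a b
        funext k
        simp only [f, PriorityLattice.act_inf, Pi.inf_apply, inf_Prop_eq, eq_iff_iff,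
          ← not_or, not_iff_not]
        exact ⟨hJ.mem_or_mem, fun h => h.elim (J.lower inf_le_left) (J.lower inf_le_right)⟩
      · funext k
        simp [f, PriorityLattice.act_bot]
      · funext k
        have := hJ.toIsProper.top_notMem
        simp [f, PriorityLattice.act_top, this]
      · intro k a
        funext l
        simp only [f, PriorityLattice.act_act]
        rfl
    rw [hf, hf, h]
  exact le_antisymm (key _ _ fun J hJ => not_imp_not.1 (hmem J hJ).1)
    (key _ _ fun J hJ => not_imp_not.1 (hmem J hJ).2)

end Separation

/-! ### Recovering a diagram from its interpretation -/

namespace Word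

variable {M : ℕ}

variable (M) in
/-- The word of `n` wires directed to the right. -/
abbrev wires (n : ℕ) : Word M := ⟨rightWires n⟩

/-- The structure of an iterated tensor product: `wires M (n + 1)` unfolds to `wire M ⊗ wires M n`,
so no transport along an equality of words is needed. -/
instance monObjWires : ∀ n : ℕ, MonObj (wires M n)
  | 0 => inferInstanceAs (MonObj (𝟙_ (Word M)))
  | n + 1 =>
    have := monObjWires n
    inferInstanceAs (MonObj (wire M ⊗ wires M n))

instance isCommMonObjWires : ∀ n : ℕ, IsCommMonObj (wires M n)
  | 0 => inferInstanceAs (IsCommMonObj (𝟙_ (Word M)))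
  | n + 1 =>
    have := isCommMonObjWires n
    inferInstanceAs (IsCommMonObj (wire M ⊗ wires M n))

/-- The coprojections to a word of wires directed to the right. -/
def coproj : ∀ n : ℕ, ℕ → MonHom (wire M) (wires M n)
  -- A default value for indices that are out of range.
  | 0, _ => ⊥
  | n + 1, 0 => ⟨monInl (wire M) (wires M n), isMonHom_monInl⟩
  | n + 1, i + 1 =>
    (coproj n i).comp (K' := wires M (n + 1)) ⟨monInr (wire M) (wires M n), isMonHom_monInr⟩

/-- By induction: the later coprojections are those of `wires M n` followed by `monInr`, so their
copairing is `monInr`, and copairing `monInl` with `monInr` gives the identity. -/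
theorem copair_coproj (n : ℕ) :
    copair (rightWires n) (allRight_rightWires n) (coproj n) = 𝟙 (wires M n) := by
  induction n with
  | zero => rfl
  | succ n ih =>
    refine .trans (congrArg (copairTwo (monInl (wire M) (wires M n)))
      (((copair_comp (K' := wires M (n + 1)) (allRight_rightWires n) (coproj n)
        ⟨monInr (wire M) (wires M n), isMonHom_monInr⟩).symm.trans ?_)))
      copairTwo_monInl_monInr
    rw [ih]
    exact Category.id_comp _

end Word

/-- Composing a diagram with the identity, written as the copairing of the coprojections, shows that
its class is the copairing of its interpretation at the coprojections. That interpretation takes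
place in the lattice `MonHom (wire M) (wires M n)`, where equality can be tested on truth values by
`Diagram.interp_eq_of_prop`. -/
theorem PGAEq.of_interp {M m n : ℕ} {c d : Diagram M (rightWires m) (rightWires n)}
    (hc : c.IsAcyclic) (hd : d.IsAcyclic)
    (h : ∀ T : ℕ → Priority M → Prop, ∀ i < m, c.interp T i 0 ↔ d.interp T i 0) : PGAEq c d := by
  have hcd (e : Diagram M (rightWires m) (rightWires n)) (he : e.IsAcyclic) :
      Word.cls (v := Word.wires M m) (w := Word.wires M n) e =
        Word.copair (rightWires m) (allRight_rightWires m) (e.interp (Word.coproj n)) := by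
    rw [← Word.cls_comp_copair e he _ (allRight_rightWires n), Word.copair_coproj, Category.comp_id]
  refine Word.cls_eq.1 ((hcd c hc).trans (.trans ?_ (hcd d hd).symm))
  refine Word.copair_congr _ fun i hi => Diagram.interp_eq_of_prop (fun T => h T i ?_) _
  simpa using hi

/-! ### Games without infinite plays and their solutions -/

namespace Game

variable {M : ℕ} {v w : List Dir}

/-- The internal positions are ranked, and the rank decreases along the edges. -/
def IsRanked (A : Game M v w) : Prop :=
  ∃ r : A.V → ℕ, ∀ x y, A.E (Sum.inr x) (Sum.inl y) → r y < r x

/-- A valuation of the positions, given the greatest priority seen before, which is locally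
consistent with the game: a position is good for Player 0 if, when it belongs to Player 0, some
successor is good, and when it belongs to Player 1, all successors are good. -/
structure IsSolution (A : Game M v w) (I : Entry v w → Priority M → Prop)
    (X : A.V → Priority M → Prop) (T : Exit v w → Priority M → Prop) : Prop where
  entry : ∀ i y, A.E (Sum.inl i) y → ∀ k, I i k ↔ Sum.elim X T y k
  player0 : ∀ x ∈ A.V₀, ∀ k, X x k ↔
    ∃ y, A.E (Sum.inr x) y ∧ Sum.elim X T y (max k (A.label x))
  player1 : ∀ x ∉ A.V₀, ∀ k, X x k ↔
    ∀ y, A.E (Sum.inr x) y → Sum.elim X T y (max k (A.label x))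

section Semantics

variable (A : Game M v w)

theorem maxPriority_append_entry (h : List (Entry v w ⊕ A.V)) (i : Entry v w) :
    A.maxPriority (h ++ [Sum.inl i]) = A.maxPriority h := by
  induction h with
  | nil => rfl
  | cons a h ih => rcases a with a | a <;> simp [maxPriority, ih]

theorem maxPriority_append_internal (h : List (Entry v w ⊕ A.V)) (x : A.V) :
    A.maxPriority (h ++ [Sum.inr x]) = max (A.maxPriority h) (A.label x) := by
  induction h with
  | nil => simp [maxPriority]
  | cons a h ih => rcases a with a | a <;> simp [maxPriority, ih, max_assoc]

/-- A strategy can choose successors with a given property whenever there are such successors. -/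
theorem exists_strategy (P : Set A.V) (Q : A.V ⊕ Exit v w → Priority M → Prop) :
    ∃ σ : A.Strategy P, ∀ (h : List (Entry v w ⊕ A.V)) (x : P),
      (∃ y, A.E (Sum.inr x.1) y ∧ Q y (max (A.maxPriority h) (A.label x))) →
        Q (σ.next h x) (max (A.maxPriority h) (A.label x)) := by
  have key : ∀ (h : List (Entry v w ⊕ A.V)) (x : P), ∃ z : A.V ⊕ Exit v w,
      ((∃ y, A.E (Sum.inr x.1) y) → A.E (Sum.inr x.1) z) ∧
      ((∃ y, A.E (Sum.inr x.1) y ∧ Q y (max (A.maxPriority h) (A.label x))) →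
        Q z (max (A.maxPriority h) (A.label x))) := by
    intro h x
    by_cases hQ : ∃ y, A.E (Sum.inr x.1) y ∧ Q y (max (A.maxPriority h) (A.label x))
    · obtain ⟨y, hy, hQy⟩ := hQ
      exact ⟨y, fun _ => hy, fun _ => hQy⟩
    · by_cases hE : ∃ y, A.E (Sum.inr x.1) y
      · obtain ⟨y, hy⟩ := hE
        exact ⟨y, fun _ => hy, fun h => absurd h hQ⟩
      -- Without an outgoing edge the play stops at `x`, and the value chosen here is never
      -- consulted.
      · exact ⟨Sum.inl x.1, fun h => absurd h hE, fun h => absurd h hQ⟩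
  choose f hf hf' using key
  exact ⟨⟨f, hf⟩, hf'⟩

variable {A}

theorem nextStage_eq_some {σ₀ : A.Strategy A.V₀} {σ₁ : A.Strategy A.V₀ᶜ} {s s' : A.Stage}
    (h : A.nextStage σ₀ σ₁ s = some s') :
    (∃ i, s.current = Sum.inl (Sum.inl i) ∧ s' = Stage.move A s.past (Sum.inl i) (A.entryNext i)) ∨
    (∃ x, ∃ hx : x ∈ A.V₀, s.current = Sum.inl (Sum.inr x) ∧ (∃ y, A.E (Sum.inr x) y) ∧
      s' = Stage.move A s.past (Sum.inr x) (σ₀.next s.past ⟨x, hx⟩)) ∨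
    (∃ x, ∃ hx : x ∉ A.V₀, s.current = Sum.inl (Sum.inr x) ∧ (∃ y, A.E (Sum.inr x) y) ∧
      s' = Stage.move A s.past (Sum.inr x) (σ₁.next s.past ⟨x, hx⟩)) := by
  rcases s with ⟨past, (i | x) | o⟩
  · simp only [nextStage, Option.some.injEq] at h
    exact Or.inl ⟨i, rfl, h.symm⟩
  · simp only [nextStage] at h
    split_ifs at h with hE hx
    · exact Or.inr (Or.inl ⟨x, hx, rfl, hE, (Option.some.inj h).symm⟩)
    · exact Or.inr (Or.inr ⟨x, hx, rfl, hE, (Option.some.inj h).symm⟩)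
  · simp [nextStage] at h

theorem nextStage_eq_none {σ₀ : A.Strategy A.V₀} {σ₁ : A.Strategy A.V₀ᶜ} {s : A.Stage}
    (h : A.nextStage σ₀ σ₁ s = none) :
    (∃ o, s.current = Sum.inr o) ∨
      ∃ x, s.current = Sum.inl (Sum.inr x) ∧ ¬ ∃ y, A.E (Sum.inr x) y := by
  rcases s with ⟨past, (i | x) | o⟩
  · simp [nextStage] at h
  · simp only [nextStage] at h
    split_ifs at h with hE
    exact Or.inr ⟨x, rfl, hE⟩
  · exact Or.inl ⟨o, rfl⟩

theorem entryNext_edge (i : Entry v w) : A.E (Sum.inl i) (A.entryNext i) :=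
  (A.entry_unique i).choose_spec.1

/-- The edge along which the play moves. -/
theorem exists_edge_of_nextStage {σ₀ : A.Strategy A.V₀} {σ₁ : A.Strategy A.V₀ᶜ} {s s' : A.Stage}
    (h : A.nextStage σ₀ σ₁ s = some s') :
    ∃ x y, s.current = Sum.inl x ∧ A.E x y ∧ s' = Stage.move A s.past x y := by
  rcases nextStage_eq_some h with ⟨i, hi, rfl⟩ | ⟨x, hx, hc, hE, rfl⟩ | ⟨x, hx, hc, hE, rfl⟩
  · exact ⟨_, _, hi, entryNext_edge i, rfl⟩
  · exact ⟨_, _, hc, σ₀.next_edge _ ⟨x, hx⟩ hE, rfl⟩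
  · exact ⟨_, _, hc, σ₁.next_edge _ ⟨x, hx⟩ hE, rfl⟩

/-- All plays of a ranked game stop. -/
theorem IsRanked.exists_play_last (hA : A.IsRanked) (σ₀ : A.Strategy A.V₀)
    (σ₁ : A.Strategy A.V₀ᶜ) (i : Entry v w) :
    ∃ n s, A.play σ₀ σ₁ i n = some s ∧ A.nextStage σ₀ σ₁ s = none := by
  obtain ⟨r, hr⟩ := hA
  have := A.finite_V
  obtain ⟨N, hN⟩ := (Set.finite_range r).bddAbove
  -- A potential that drops with every move: exits lie at `0`, internal positions between `1` and `N
  -- + 1`, entries at `N + 2`. A play can thus not make `N + 3` moves.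
  let R : (Entry v w ⊕ A.V) ⊕ Exit v w → ℕ :=
    Sum.elim (Sum.elim (fun _ => N + 2) (fun x => r x + 1)) (fun _ => 0)
  have hR : ∀ s s', A.nextStage σ₀ σ₁ s = some s' → R s'.current < R s.current := by
    intro s s' h
    obtain ⟨x, y, hx, hE, rfl⟩ := exists_edge_of_nextStage h
    rw [hx]
    rcases x with i | x <;> rcases y with y | o
    · have := hN (Set.mem_range_self y)
      simp [R, Stage.move]
      omega
    · simp [R, Stage.move]
    · have := hr x y hE
      simp [R, Stage.move]
      omega
    · simp [R, Stage.move]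
  by_contra hno
  push Not at hno
  have hall : ∀ n, ∃ s, A.play σ₀ σ₁ i n = some s ∧ R s.current + n ≤ N + 2 := by
    intro n
    induction n with
    | zero => exact ⟨_, rfl, by simp [R]⟩
    | succ n ih =>
      obtain ⟨s, hs, hle⟩ := ih
      obtain ⟨s', hs'⟩ := Option.ne_none_iff_exists'.1 (hno n s hs)
      refine ⟨s', by simp [play, hs, hs'], ?_⟩
      have := hR s s' hs'
      omega
  obtain ⟨s, -, hs⟩ := hall (N + 3)
  omega

theorem IsRanked.exists_play_eq_none (hA : A.IsRanked) (σ₀ : A.Strategy A.V₀)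
    (σ₁ : A.Strategy A.V₀ᶜ) (i : Entry v w) : ∃ n, A.play σ₀ σ₁ i n = none := by
  obtain ⟨n, s, hs, hs'⟩ := hA.exists_play_last σ₀ σ₁ i
  exact ⟨n + 1, by simp [play, hs, hs']⟩

/-- Induction along a play. -/
theorem play_induction {σ₀ : A.Strategy A.V₀} {σ₁ : A.Strategy A.V₀ᶜ} {i : Entry v w}
    {Q : A.Stage → Prop} (h0 : Q ⟨[], Sum.inl (Sum.inl i)⟩)
    (hstep : ∀ s s', Q s → A.nextStage σ₀ σ₁ s = some s' → Q s') {n : ℕ} {s : A.Stage}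
    (hs : A.play σ₀ σ₁ i n = some s) : Q s := by
  induction n generalizing s with
  | zero =>
    cases hs
    exact h0
  | succ n ih =>
    obtain ⟨s', hs', h⟩ := Option.bind_eq_some_iff.1 hs
    exact hstep s' s (ih hs') h

/-- Backward induction, stated as an invariant of plays. Player 0 can keep a true value true and
Player 1 can keep a false value false, each by a choice that depends only on the position and the
greatest priority seen. Every play stops, and the value then agrees with the result: at an exit it
is `T`, at a stuck position of Player 0 the existential condition is false, and at one of Player 1
the universal condition is vacuously true. -/
theorem IsSolution.mem_semantics {I : Entry v w → Priority M → Prop}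
    {X : A.V → Priority M → Prop} {T : Exit v w → Priority M → Prop} (h : A.IsSolution I X T)
    (hA : A.IsRanked) (i : Entry v w) : ({e | T e.1 e.2}, i) ∈ A.semantics ↔ I i 0 := by
  let Q : A.Stage → Prop := fun s => Sum.elim (Sum.elim I X) T s.current (A.maxPriority s.past)
  have hmove : ∀ past x y, Q (Stage.move A past x y) ↔
      Sum.elim X T y (A.maxPriority (past ++ [x])) := by
    rintro past x (y | y) <;> rfl
  have hentry : ∀ past i, Q ⟨past, Sum.inl (Sum.inl i)⟩ ↔
      Q (Stage.move A past (Sum.inl i) (A.entryNext i)) := by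
    intro past i
    rw [hmove, maxPriority_append_entry]
    exact h.entry i _ (entryNext_edge i) _
  constructor
  · rintro ⟨σ₀, hlose, hout⟩
    by_contra hI
    -- Player 1 moves to a false successor whenever there is one; this single strategy refutes the
    -- given `σ₀`.
    obtain ⟨σ₁, hσ₁⟩ := A.exists_strategy A.V₀ᶜ fun y k => ¬ Sum.elim X T y k
    have hQ : ∀ n s, A.play σ₀ σ₁ i n = some s → ¬ Q s := by
      intro n s
      refine play_induction (Q := fun s => ¬ Q s) hI ?_
      rintro ⟨past, cur⟩ s' hs hs'
      rcases nextStage_eq_some hs' with ⟨i, hi, rfl⟩ | ⟨x, hx, hc, hE, rfl⟩ | ⟨x, hx, hc, hE, rfl⟩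
      · obtain rfl : cur = _ := hi
        rwa [← hentry]
      · obtain rfl : cur = _ := hc
        rw [hmove, maxPriority_append_internal]
        exact fun hy => hs ((h.player0 x hx _).2 ⟨_, σ₀.next_edge past ⟨x, hx⟩ hE, hy⟩)
      · obtain rfl : cur = _ := hc
        rw [hmove, maxPriority_append_internal]
        refine hσ₁ past ⟨x, hx⟩ ?_
        by_contra hno
        push Not at hno
        exact hs ((h.player1 x hx _).2 hno)
    obtain ⟨n, ⟨past, cur⟩, hs, hlast⟩ := hA.exists_play_last σ₀ σ₁ i
    have hs' := hQ n _ hs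
    rcases nextStage_eq_none hlast with ⟨o, ho⟩ | ⟨x, hx, hE⟩
    · obtain rfl : cur = _ := ho
      exact hs' (hout (a := (o, A.maxPriority past)) ⟨σ₁, .exit hs⟩)
    · obtain rfl : cur = _ := hx
      by_cases hx : x ∈ A.V₀
      · exact hlose ⟨σ₁, .stuck₀ hs hx hE⟩
      · exact hs' ((h.player1 x hx _).2 fun y hy => absurd ⟨y, hy⟩ hE)
  · intro hI
    -- Dually, Player 0 moves to a true successor whenever there is one, against every `σ₁`.
    obtain ⟨σ₀, hσ₀⟩ := A.exists_strategy A.V₀ (Sum.elim X T)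
    have hQ : ∀ σ₁ n s, A.play σ₀ σ₁ i n = some s → Q s := by
      intro σ₁ n s
      refine play_induction hI ?_
      rintro ⟨past, cur⟩ s' hs hs'
      rcases nextStage_eq_some hs' with ⟨i, hi, rfl⟩ | ⟨x, hx, hc, hE, rfl⟩ | ⟨x, hx, hc, hE, rfl⟩
      · obtain rfl : cur = _ := hi
        rwa [← hentry]
      · obtain rfl : cur = _ := hc
        rw [hmove, maxPriority_append_internal]
        exact hσ₀ past ⟨x, hx⟩ ((h.player0 x hx _).1 hs)
      · obtain rfl : cur = _ := hc
        rw [hmove, maxPriority_append_internal]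
        exact (h.player1 x hx _).1 hs _ (σ₁.next_edge past ⟨x, hx⟩ hE)
    refine ⟨σ₀, ?_, ?_⟩
    · rintro ⟨σ₁, hd⟩
      cases hd with
      | stuck₀ hn hx hE =>
        obtain ⟨y, hy, -⟩ := (h.player0 _ hx _).1 (hQ σ₁ _ _ hn)
        exact hE ⟨y, hy⟩
      | odd hinf _ _ =>
        obtain ⟨n, hn⟩ := hA.exists_play_eq_none σ₀ σ₁ i
        exact hinf n hn
    · rintro ⟨o, k⟩ ⟨σ₁, hd⟩
      cases hd with
      | exit hn => exact hQ σ₁ _ _ hn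

end Semantics

/-! ### Solutions of elementary games, juxtapositions and compositions -/

variable {M : ℕ} {u v w v' w' : List Dir}

theorem isRanked_single (owner₀ : Prop) (p : Priority M) : (single v w owner₀ p).IsRanked :=
  ⟨fun _ => 0, fun _ _ h => h.elim⟩

theorem isSolution_single {owner₀ : Prop} {p : Priority M} {I : Entry v w → Priority M → Prop}
    {T : Exit v w → Priority M → Prop} {X : Priority M → Prop} (hI : ∀ i k, I i k ↔ X k)
    (h₀ : owner₀ → ∀ k, X k ↔ ∃ o, T o (max k p)) (h₁ : ¬ owner₀ → ∀ k, X k ↔ ∀ o, T o (max k p)) :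
    (single v w owner₀ p).IsSolution I (fun _ => X) T where
  entry i y hy k := by
    rcases y with y | y
    · exact hI i k
    · exact hy.elim
  player0 x hx k := by
    rw [h₀ hx k]
    constructor
    · rintro ⟨o, ho⟩
      exact ⟨Sum.inr o, trivial, ho⟩
    · rintro ⟨y | o, hy, ho⟩
      · exact hy.elim
      · exact ⟨o, ho⟩
  player1 x hx k := by
    rw [h₁ hx k]
    constructor
    · rintro h (y | o) hy
      · exact hy.elim
      · exact h o
    · exact fun h o => h (Sum.inr o) trivial

theorem isRanked_wires (e : Entry v w ≃ Exit v w) : (wires (M := M) e).IsRanked :=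
  ⟨fun _ => 0, fun x => x.elim⟩

theorem isSolution_wires {e : Entry v w ≃ Exit v w} {I : Entry v w → Priority M → Prop}
    {T : Exit v w → Priority M → Prop} (hI : ∀ i k, I i k ↔ T (e i) k) :
    (wires e).IsSolution I (fun x => Empty.elim x) T where
  entry i y hy k := by
    rcases y with y | y
    · exact hy.elim
    · obtain rfl : e i = y := hy
      exact hI i k
  player0 x := x.elim
  player1 x := x.elim

/-- The edges `E` and `E'` lead to targets with the same values. -/
def Matches {α β : Type} (E : α → Prop) (f : α → Priority M → Prop) (E' : β → Prop)
    (f' : β → Priority M → Prop) : Prop :=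
  (∀ t, E' t → ∃ y, E y ∧ ∀ k, f y k ↔ f' t k) ∧ ∀ y, E y → ∃ t, E' t ∧ ∀ k, f y k ↔ f' t k

section Matches

variable {α β : Type} {E : α → Prop} {f : α → Priority M → Prop} {E' : β → Prop}
  {f' : β → Priority M → Prop}

theorem Matches.exists_iff (h : Matches E f E' f') (k : Priority M) :
    (∃ y, E y ∧ f y k) ↔ ∃ t, E' t ∧ f' t k := by
  constructor
  · rintro ⟨y, hy, hf⟩
    obtain ⟨t, ht, hk⟩ := h.2 y hy
    exact ⟨t, ht, (hk k).1 hf⟩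
  · rintro ⟨t, ht, hf⟩
    obtain ⟨y, hy, hk⟩ := h.1 t ht
    exact ⟨y, hy, (hk k).2 hf⟩

theorem Matches.forall_iff (h : Matches E f E' f') (k : Priority M) :
    (∀ y, E y → f y k) ↔ ∀ t, E' t → f' t k := by
  constructor
  · intro hf t ht
    obtain ⟨y, hy, hk⟩ := h.1 t ht
    exact (hk k).1 (hf y hy)
  · intro hf y hy
    obtain ⟨t, ht, hk⟩ := h.2 y hy
    exact (hk k).2 (hf t ht)

end Matches

section Tensor

variable (A : Game M v w) (B : Game M v' w')

theorem tensorEdge_fst_iff (s : Entry v w ⊕ A.V) (t) :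
    TensorEdge A B (Sum.map (fun i => tensorEntry v w v' w' (Sum.inl i)) Sum.inl s) t ↔
      ∃ y, A.E s y ∧ t = Sum.map Sum.inl (fun o => tensorExit v w v' w' (Sum.inl o)) y := by
  constructor
  · intro h
    generalize hs : (Sum.map (fun i => tensorEntry v w v' w' (Sum.inl i)) Sum.inl s :
      Entry (v ++ v') (w ++ w') ⊕ (A.V ⊕ B.V)) = s' at h
    rcases h with @⟨x, y, h⟩ | @⟨x, y, h⟩
    · have : s = x := by rcases s with s | s <;> rcases x with x | x <;> simp at hs <;> rw [hs]
      exact ⟨y, this ▸ h, rfl⟩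
    · rcases s with s | s <;> rcases x with x | x <;> simp at hs
  · rintro ⟨y, hy, rfl⟩
    exact .fst hy

theorem tensorEdge_snd_iff (s : Entry v' w' ⊕ B.V) (t) :
    TensorEdge A B (Sum.map (fun i => tensorEntry v w v' w' (Sum.inr i)) Sum.inr s) t ↔
      ∃ y, B.E s y ∧ t = Sum.map Sum.inr (fun o => tensorExit v w v' w' (Sum.inr o)) y := by
  constructor
  · intro h
    generalize hs : (Sum.map (fun i => tensorEntry v w v' w' (Sum.inr i)) Sum.inr s :
      Entry (v ++ v') (w ++ w') ⊕ (A.V ⊕ B.V)) = s' at h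
    rcases h with @⟨x, y, h⟩ | @⟨x, y, h⟩
    · rcases s with s | s <;> rcases x with x | x <;> simp at hs
    · have : s = x := by rcases s with s | s <;> rcases x with x | x <;> simp at hs <;> rw [hs]
      exact ⟨y, this ▸ h, rfl⟩
  · rintro ⟨y, hy, rfl⟩
    exact .snd hy

variable {A B}

theorem IsRanked.tensor (hA : A.IsRanked) (hB : B.IsRanked) : (A.tensor B).IsRanked := by
  obtain ⟨r, hr⟩ := hA
  obtain ⟨r', hr'⟩ := hB
  refine ⟨Sum.elim r r', ?_⟩
  rintro (x | x) t h
  · obtain ⟨y | y, hy, ht⟩ := (tensorEdge_fst_iff A B (Sum.inr x) _).1 h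
    · obtain rfl := Sum.inl_injective ht
      exact hr x y hy
    · simp at ht
  · obtain ⟨y | y, hy, ht⟩ := (tensorEdge_snd_iff A B (Sum.inr x) _).1 h
    · obtain rfl := Sum.inl_injective ht
      exact hr' x y hy
    · simp at ht

variable {I : Entry (v ++ v') (w ++ w') → Priority M → Prop}
  {T : Exit (v ++ v') (w ++ w') → Priority M → Prop} {X : A.V → Priority M → Prop}
  {X' : B.V → Priority M → Prop}

theorem matches_tensor_fst (s : Entry v w ⊕ A.V) :
    Matches (A.E s) (Sum.elim X fun o => T (tensorExit v w v' w' (Sum.inl o)))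
      (TensorEdge A B (Sum.map (fun i => tensorEntry v w v' w' (Sum.inl i)) Sum.inl s))
      (Sum.elim (Sum.elim X X') T) := by
  constructor
  · intro t ht
    obtain ⟨y, hy, rfl⟩ := (tensorEdge_fst_iff A B s t).1 ht
    refine ⟨y, hy, fun k => ?_⟩
    rcases y with y | y <;> rfl
  · intro y hy
    refine ⟨_, .fst hy, fun k => ?_⟩
    rcases y with y | y <;> rfl

theorem matches_tensor_snd (s : Entry v' w' ⊕ B.V) :
    Matches (B.E s) (Sum.elim X' fun o => T (tensorExit v w v' w' (Sum.inr o)))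
      (TensorEdge A B (Sum.map (fun i => tensorEntry v w v' w' (Sum.inr i)) Sum.inr s))
      (Sum.elim (Sum.elim X X') T) := by
  constructor
  · intro t ht
    obtain ⟨y, hy, rfl⟩ := (tensorEdge_snd_iff A B s t).1 ht
    refine ⟨y, hy, fun k => ?_⟩
    rcases y with y | y <;> rfl
  · intro y hy
    refine ⟨_, .snd hy, fun k => ?_⟩
    rcases y with y | y <;> rfl

theorem IsSolution.tensor
    (hA : A.IsSolution (fun i => I (tensorEntry v w v' w' (Sum.inl i))) X
      fun o => T (tensorExit v w v' w' (Sum.inl o)))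
    (hB : B.IsSolution (fun i => I (tensorEntry v w v' w' (Sum.inr i))) X'
      fun o => T (tensorExit v w v' w' (Sum.inr o))) :
    (A.tensor B).IsSolution I (Sum.elim X X') T where
  entry i t ht k := by
    obtain ⟨i | i, rfl⟩ := (tensorEntry v w v' w').surjective i
    · obtain ⟨y, hy, hk⟩ := (matches_tensor_fst (Sum.inl i)).1 t ht
      exact (hA.entry i y hy k).trans (hk k)
    · obtain ⟨y, hy, hk⟩ := (matches_tensor_snd (Sum.inl i)).1 t ht
      exact (hB.entry i y hy k).trans (hk k)
  player0 x hx k := by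
    rcases x with x | x
    · exact (hA.player0 x hx k).trans ((matches_tensor_fst (Sum.inr x)).exists_iff _)
    · exact (hB.player0 x hx k).trans ((matches_tensor_snd (Sum.inr x)).exists_iff _)
  player1 x hx k := by
    rcases x with x | x
    · exact (hA.player1 x hx k).trans ((matches_tensor_fst (Sum.inr x)).forall_iff _)
    · exact (hB.player1 x hx k).trans ((matches_tensor_snd (Sum.inr x)).forall_iff _)

end Tensor

section Comp

variable (A : Game M u v) (B : Game M v w)

theorem glue_srcFst_iff (s : Entry u v ⊕ A.V) (t) :
    Glue A B (srcFst B.V w s) t ↔ ∃ y, A.E s y ∧ t = tgtFst B.V w y := by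
  constructor
  · intro h
    generalize hs : srcFst B.V w s = s' at h
    rcases h with @⟨x, y, h⟩ | @⟨x, y, h⟩
    · have : s = x := by
        rcases s with (s | s) | s <;> rcases x with (x | x) | x <;> simp [srcFst] at hs <;> rw [hs]
      exact ⟨y, this ▸ h, rfl⟩
    · rcases s with (s | s) | s <;> rcases x with (x | x) | x <;> simp [srcFst, srcSnd] at hs
  · rintro ⟨y, hy, rfl⟩
    exact .fst hy

theorem glue_srcSnd_iff (s : Entry v w ⊕ B.V) (t) :
    Glue A B (srcSnd A.V u s) t ↔ ∃ y, B.E s y ∧ t = tgtSnd A.V u y := by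
  constructor
  · intro h
    generalize hs : srcSnd A.V u s = s' at h
    rcases h with @⟨x, y, h⟩ | @⟨x, y, h⟩
    · rcases s with (s | s) | s <;> rcases x with (x | x) | x <;> simp [srcFst, srcSnd] at hs
    · have : s = x := by
        rcases s with (s | s) | s <;> rcases x with (x | x) | x <;> simp [srcSnd] at hs <;> rw [hs]
      exact ⟨y, this ▸ h, rfl⟩
  · rintro ⟨y, hy, rfl⟩
    exact .snd hy

variable {A B}

variable [IsEmpty (Port v .left)]

/-- Without left wires in the middle, no edge of the second game leads back to the first. A path
that starts in the second game is thus a single edge, and one that starts in the first game crosses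
at most one middle wire. -/
theorem through_srcSnd_iff (s : Entry v w ⊕ B.V) (t) :
    Through (Glue A B) (srcSnd A.V u s) t ↔ ∃ y, B.E s y ∧ tgtSnd A.V u y = Sum.inr t := by
  constructor
  · rintro (h | @⟨_, m, _, h, h'⟩)
    · obtain ⟨y, hy, ht⟩ := (glue_srcSnd_iff A B s _).1 h
      exact ⟨y, hy, ht.symm⟩
    · obtain ⟨y | (y | y), hy, ht⟩ := (glue_srcSnd_iff A B s _).1 h
      · simp [tgtSnd] at ht
      · exact isEmptyElim y
      · simp [tgtSnd] at ht
  · rintro ⟨y, hy, ht⟩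
    exact .last (ht ▸ .snd hy)

theorem through_srcFst_iff (s : Entry u v ⊕ A.V) (t) :
    Through (Glue A B) (srcFst B.V w s) t ↔ ∃ y, A.E s y ∧ (tgtFst B.V w y = Sum.inr t ∨
      ∃ p y', y = Sum.inr (Sum.inr p) ∧ B.E (Sum.inl (Sum.inl p)) y' ∧
        tgtSnd A.V u y' = Sum.inr t) := by
  constructor
  · rintro (h | @⟨_, m, _, h, h'⟩)
    · obtain ⟨y, hy, ht⟩ := (glue_srcFst_iff A B s _).1 h
      exact ⟨y, hy, .inl ht.symm⟩
    · obtain ⟨y | (y | p), hy, ht⟩ := (glue_srcFst_iff A B s _).1 h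
      · simp [tgtFst] at ht
      · simp [tgtFst] at ht
      · obtain rfl := Sum.inl_injective ht
        obtain ⟨y', hy', ht'⟩ := (through_srcSnd_iff (Sum.inl (Sum.inl p)) t).1 h'
        exact ⟨_, hy, .inr ⟨p, y', rfl, hy', ht'⟩⟩
  · rintro ⟨y, hy, ht | ⟨p, y', rfl, hy', ht⟩⟩
    · exact .last (ht ▸ .fst hy)
    · exact .step (.fst hy) ((through_srcSnd_iff (Sum.inl (Sum.inl p)) t).2 ⟨y', hy', ht⟩)

theorem IsRanked.comp (hA : A.IsRanked) (hB : B.IsRanked) : (A.comp B).IsRanked := by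
  obtain ⟨r, hr⟩ := hA
  obtain ⟨r', hr'⟩ := hB
  have := B.finite_V
  obtain ⟨N, hN⟩ := (Set.finite_range r').bddAbove
  -- Play only passes from the first game to the second, so the first is ranked entirely above the
  -- bound `N` for the second.
  refine ⟨Sum.elim (fun x => N + 1 + r x) r', ?_⟩
  change ∀ x y : A.V ⊕ B.V, Through (Glue A B) (Sum.inl (Sum.inr x)) (Sum.inl y) → _
  rintro (x | x) (t | t) h
  · obtain ⟨y, hy, ht | ⟨p, y', -, -, ht⟩⟩ := (through_srcFst_iff (Sum.inr x) _).1 h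
    · rcases y with y | (y | y) <;> simp [tgtFst] at ht
      subst ht
      exact Nat.add_lt_add_left (hr x y hy) _
    · rcases y' with y' | (y' | y') <;> simp [tgtSnd] at ht
  · have := hN (Set.mem_range_self t)
    simp only [Sum.elim_inl, Sum.elim_inr]
    omega
  · obtain ⟨y, hy, ht⟩ := (through_srcSnd_iff (Sum.inr x) _).1 h
    rcases y with y | (y | y) <;> simp [tgtSnd] at ht
  · obtain ⟨y, hy, ht⟩ := (through_srcSnd_iff (Sum.inr x) _).1 h
    rcases y with y | (y | y) <;> simp [tgtSnd] at ht
    subst ht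
    exact hr' x y hy

variable {I : Entry u v → Priority M → Prop} {T : Exit u v → Priority M → Prop}
  {I' : Entry v w → Priority M → Prop} {T' : Exit v w → Priority M → Prop}
  {X : A.V → Priority M → Prop} {X' : B.V → Priority M → Prop}

theorem matches_comp_snd (s : Entry v w ⊕ B.V) :
    Matches (B.E s) (Sum.elim X' T') (Through (Glue A B) (srcSnd A.V u s))
      (Sum.elim (Sum.elim X X') (Sum.elim (fun p => T (Sum.inl p)) fun p => T' (Sum.inr p))) := by
  constructor
  · intro t ht
    obtain ⟨y, hy, ht⟩ := (through_srcSnd_iff s t).1 ht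
    refine ⟨y, hy, fun k => ?_⟩
    rcases y with y | (y | y)
    · obtain rfl := Sum.inr_injective ht
      rfl
    · exact isEmptyElim y
    · obtain rfl := Sum.inr_injective ht
      rfl
  · intro y hy
    rcases y with y | (y | y)
    · exact ⟨_, (through_srcSnd_iff s _).2 ⟨_, hy, rfl⟩, fun k => .rfl⟩
    · exact isEmptyElim y
    · exact ⟨_, (through_srcSnd_iff s _).2 ⟨_, hy, rfl⟩, fun k => .rfl⟩

/-- An edge of the first game into a middle wire is prolonged by the unique edge of the second game
out of the corresponding entry. The value survives the prolongation: `hmid` equates the wire with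
that entry, and the solution of the second game equates the entry with its successor. -/
theorem matches_comp_fst (hB : B.IsSolution I' X' T')
    (hmid : ∀ p k, T (Sum.inr p) k ↔ I' (Sum.inl p) k) (s : Entry u v ⊕ A.V) :
    Matches (A.E s) (Sum.elim X T) (Through (Glue A B) (srcFst B.V w s))
      (Sum.elim (Sum.elim X X') (Sum.elim (fun p => T (Sum.inl p)) fun p => T' (Sum.inr p))) := by
  have hport (p : Port v .right) := matches_comp_snd (A := A) (X := X) (X' := X') (T := T)
    (T' := T') (B := B) (Sum.inl (Sum.inl p))
  constructor
  · intro t ht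
    obtain ⟨y, hy, ht | ⟨p, y', rfl, hy', ht⟩⟩ := (through_srcFst_iff s t).1 ht
    · refine ⟨y, hy, fun k => ?_⟩
      rcases y with y | (y | y)
      · obtain rfl := Sum.inr_injective ht
        rfl
      · obtain rfl := Sum.inr_injective ht
        rfl
      · simp [tgtFst] at ht
    · refine ⟨_, hy, fun k => ?_⟩
      obtain ⟨z, hz, hk⟩ := (hport p).1 t ((through_srcSnd_iff _ _).2 ⟨y', hy', ht⟩)
      exact (hmid p k).trans ((hB.entry _ z hz k).trans (hk k))
  · intro y hy
    rcases y with y | (y | p)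
    · exact ⟨_, (through_srcFst_iff s _).2 ⟨_, hy, .inl rfl⟩, fun k => .rfl⟩
    · exact ⟨_, (through_srcFst_iff s _).2 ⟨_, hy, .inl rfl⟩, fun k => .rfl⟩
    · obtain ⟨z, hz, -⟩ := B.entry_unique (Sum.inl p)
      obtain ⟨t, ht, hk⟩ := (hport p).2 z hz
      obtain ⟨y', hy', ht'⟩ := (through_srcSnd_iff _ _).1 ht
      exact ⟨t, (through_srcFst_iff s _).2 ⟨_, hy, .inr ⟨p, y', rfl, hy', ht'⟩⟩,
        fun k => (hmid p k).trans ((hB.entry _ z hz k).trans (hk k))⟩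

theorem IsSolution.comp (hA : A.IsSolution I X T) (hB : B.IsSolution I' X' T')
    (hmid : ∀ p k, T (Sum.inr p) k ↔ I' (Sum.inl p) k) :
    (A.comp B).IsSolution (Sum.elim (fun p => I (Sum.inl p)) fun p => I' (Sum.inr p))
      (Sum.elim X X') (Sum.elim (fun p => T (Sum.inl p)) fun p => T' (Sum.inr p)) where
  entry i t ht k := by
    rcases i with p | p
    · obtain ⟨y, hy, hk⟩ := (matches_comp_fst hB hmid (Sum.inl (Sum.inl p))).1 t ht
      exact (hA.entry _ y hy k).trans (hk k)
    · obtain ⟨y, hy, hk⟩ := (matches_comp_snd (Sum.inl (Sum.inr p))).1 t ht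
      exact (hB.entry _ y hy k).trans (hk k)
  player0 x hx k := by
    rcases x with x | x
    · exact (hA.player0 x hx k).trans ((matches_comp_fst hB hmid (Sum.inr x)).exists_iff _)
    · exact (hB.player0 x hx k).trans ((matches_comp_snd (Sum.inr x)).exists_iff _)
  player1 x hx k := by
    rcases x with x | x
    · exact (hA.player1 x hx k).trans ((matches_comp_fst hB hmid (Sum.inr x)).forall_iff _)
    · exact (hB.player1 x hx k).trans ((matches_comp_snd (Sum.inr x)).forall_iff _)

end Comp

end Game

/-! ### The interpretation of an acyclic diagram solves its game -/

theorem AllRight.isEmpty_port {v : List Dir} (h : AllRight v) : IsEmpty (Port v .left) :=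
  ⟨fun p => by
    have h₁ := h _ (List.get_mem v p.1)
    have h₂ := p.2
    rw [h₁] at h₂
    cases h₂⟩

variable {M : ℕ}

/-- The valuation of the entries given by values of the wires on the left. -/
def entryVal (v w : List Dir) (x : ℕ → Priority M → Prop) : Entry v w → Priority M → Prop :=
  Sum.elim (fun p => x p.1.val) fun _ _ => False

/-- The valuation of the exits given by values of the wires on the right. -/
def exitVal (v w : List Dir) (x : ℕ → Priority M → Prop) : Exit v w → Priority M → Prop :=
  Sum.elim (fun _ _ => False) fun p => x p.1.val

theorem forall_exitVal {v w : List Dir} (hv : AllRight v) (hw : AllRight w)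
    (x : ℕ → Priority M → Prop) (k : Priority M) :
    (∀ o : Exit v w, exitVal v w x o k) ↔ ∀ j < w.length, x j k := by
  have := hv.isEmpty_port
  constructor
  · exact fun h j hj => h (Sum.inr ⟨⟨j, hj⟩, hw _ (List.get_mem w _)⟩)
  · rintro h (o | o)
    · exact isEmptyElim o
    · exact h _ o.1.2

theorem exists_exitVal {v w : List Dir} (hw : AllRight w)
    (x : ℕ → Priority M → Prop) (k : Priority M) :
    (∃ o : Exit v w, exitVal v w x o k) ↔ ∃ j < w.length, x j k := by
  constructor
  · rintro ⟨o | o, h⟩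
    · exact h.elim
    · exact ⟨_, o.1.2, h⟩
  · exact fun ⟨j, hj, h⟩ => ⟨Sum.inr ⟨⟨j, hj⟩, hw _ (List.get_mem w _)⟩, h⟩

theorem entryVal_iff {v w : List Dir} (hw : AllRight w) {x : ℕ → Priority M → Prop}
    {X : Priority M → Prop} (h : ∀ j < v.length, x j = X) (i : Entry v w) (k : Priority M) :
    entryVal v w x i k ↔ X k := by
  have := hw.isEmpty_port
  rcases i with p | p
  · simp only [entryVal, Sum.elim_inl, h _ p.1.2]
  · exact isEmptyElim p

theorem Port.swap_val (v w : List Dir) {a : Dir} (p : Port (v ++ w) a) :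
    (Port.swap v w a p).1.val =
      if p.1.val < v.length then w.length + p.1.val else p.1.val - v.length := by
  obtain ⟨q | q, rfl⟩ := (Port.append v w a).surjective p
  · have h : Port.swap v w a (Port.append v w a (Sum.inl q)) = Port.inr q := by
      simp only [Port.swap, Equiv.trans_apply, Equiv.symm_apply_apply]
      rfl
    rw [h]
    have hq := q.1.2
    simp [Port.append, Port.inl, Port.inr]
  · have h : Port.swap v w a (Port.append v w a (Sum.inr q)) = Port.inl q := by
      simp only [Port.swap, Equiv.trans_apply, Equiv.symm_apply_apply]
      rfl
    rw [h]
    simp [Port.append, Port.inl, Port.inr]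

theorem Gen.isRanked {v w : List Dir} (g : Gen M v w) : g.toGame.IsRanked := by
  cases g
  case cap => exact ⟨fun _ => 0, fun x => x.elim⟩
  case cup => exact ⟨fun _ => 0, fun x => x.elim⟩
  all_goals exact Game.isRanked_single _ _

theorem Gen.exists_isSolution {v w : List Dir} (g : Gen M v w) (hg : IsAcyclicGen g)
    (x : ℕ → Priority M → Prop) :
    ∃ X, g.toGame.IsSolution (entryVal v w (g.interp x)) X (exitVal v w x) := by
  have h₀ : AllRight [] := by simp [AllRight]
  have h₁ : AllRight [.right] := by simp [AllRight]
  have h₂ : AllRight [.right, .right] := by simp [AllRight]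
  cases g with
  | player0 =>
    refine ⟨_, Game.isSolution_single (X := x 0 ⊔ x 1) (entryVal_iff h₂ fun _ _ => rfl) ?_ ?_⟩
    · intro _ k
      simp [exists_exitVal h₂, Nat.le_one_iff_eq_zero_or_eq_one, or_and_right, exists_or]
    · exact fun h => (h trivial).elim
  | lose0 =>
    refine ⟨_, Game.isSolution_single (X := ⊥) (entryVal_iff h₀ fun _ _ => rfl) ?_ ?_⟩
    · intro _ k
      simp [exists_exitVal h₀]
    · exact fun h => (h trivial).elim
  | player1 =>
    refine ⟨_, Game.isSolution_single (X := x 0 ⊓ x 1) (entryVal_iff h₂ fun _ _ => rfl) ?_ ?_⟩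
    · exact fun h => h.elim
    · intro _ k
      rw [forall_exitVal h₁ h₂]
      simp [Nat.le_one_iff_eq_zero_or_eq_one]
  | lose1 =>
    refine ⟨_, Game.isSolution_single (X := ⊤) (entryVal_iff h₀ fun _ _ => rfl) ?_ ?_⟩
    · exact fun h => h.elim
    · intro _ k
      rw [forall_exitVal h₁ h₀]
      simp
  | merge =>
    refine ⟨_, Game.isSolution_single (X := x 0) (entryVal_iff h₁ fun _ _ => rfl) ?_ ?_⟩
    · exact fun h => h.elim
    · intro _ k
      rw [forall_exitVal h₂ h₁]
      simp
  | start =>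
    -- The position takes its value from the exit. The default `⊥` in the interpretation plays no
    -- role, since there are no entries.
    refine ⟨_, Game.isSolution_single (X := x 0) (entryVal_iff h₁ (by simp)) ?_ ?_⟩
    · exact fun h => h.elim
    · intro _ k
      rw [forall_exitVal h₀ h₁]
      simp
  | prio p =>
    refine ⟨_, Game.isSolution_single (X := fun k => x 0 (max k p))
      (entryVal_iff h₁ fun _ _ => rfl) ?_ ?_⟩
    · exact fun h => h.elim
    · intro _ k
      rw [forall_exitVal h₁ h₁]
      simp
  | cap => rcases hg with h | h | h | h <;> cases h
  | cup => rcases hg with h | h | h | h <;> cases h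

theorem Diagram.isRanked {v w : List Dir} (c : Diagram M v w) (hc : c.IsAcyclic)
    (hv : AllRight v) : c.toGame.IsRanked := by
  induction c with
  | gen g => exact g.isRanked
  | id v => exact Game.isRanked_wires _
  | swap v w => exact Game.isRanked_wires _
  | comp c d ihc ihd =>
    have hw := IsAcyclic.allRight hc.1 hv
    have := hw.isEmpty_port
    exact (ihc hc.1 hv).comp (ihd hc.2 hw)
  | tensor c d ihc ihd =>
    obtain ⟨hv, hv'⟩ := allRight_append.1 hv
    exact (ihc hc.1 hv).tensor (ihd hc.2 hv')

/-- The interpretation of an acyclic diagram solves its game. -/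
theorem Diagram.exists_isSolution {v w : List Dir} (c : Diagram M v w) (hc : c.IsAcyclic)
    (hv : AllRight v) (x : ℕ → Priority M → Prop) :
    ∃ X, c.toGame.IsSolution (entryVal v w (c.interp x)) X (exitVal v w x) := by
  induction c generalizing x with
  | gen g => exact g.exists_isSolution hc x
  | id v =>
    have := hv.isEmpty_port
    refine ⟨_, Game.isSolution_wires ?_⟩
    rintro (p | p) k
    · exact .rfl
    · exact isEmptyElim p
  | swap v w =>
    have := (hc.allRight hv).isEmpty_port
    refine ⟨_, Game.isSolution_wires ?_⟩
    rintro (p | p) k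
    · change _ ↔ x (Port.swap v w .right p).1.val k
      rw [Port.swap_val]
      simp only [entryVal, Sum.elim_inl, interp]
      split <;> rfl
    · exact isEmptyElim p
  | @comp u v w c d ihc ihd =>
    have hw := IsAcyclic.allRight hc.1 hv
    have := hw.isEmpty_port
    obtain ⟨X', hd⟩ := ihd hc.2 hw x
    -- Values travel backwards: those which `d` gives to its entries are the goals at the exits of
    -- `c`.
    obtain ⟨X, hc⟩ := ihc hc.1 hv (d.interp x)
    refine ⟨Sum.elim X X', ?_⟩
    convert! hc.comp hd fun p k => .rfl using 1
  | @tensor v w v' w' c d ihc ihd =>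
    obtain ⟨hv, hv'⟩ := allRight_append.1 hv
    have := (IsAcyclic.allRight hc.1 hv).isEmpty_port
    have := (IsAcyclic.allRight hc.2 hv').isEmpty_port
    have := hv.isEmpty_port
    have := hv'.isEmpty_port
    obtain ⟨X', hd⟩ := ihd hc.2 hv' fun j => x (w.length + j)
    obtain ⟨X, hc⟩ := ihc hc.1 hv x
    refine ⟨_, Game.IsSolution.tensor (X := X) (X' := X') ?_ ?_⟩
    · convert! hc using 1
      · funext i
        rcases i with i | i
        · have := i.1.2
          simp [entryVal, Game.tensorEntry, Port.append, Port.inl, interp]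
        · exact isEmptyElim i
      · funext o
        rcases o with o | o
        · exact isEmptyElim o
        · simp [exitVal, Game.tensorExit, Port.append, Port.inl]
    · convert! hd using 1
      · funext i
        rcases i with i | i
        · simp [entryVal, Game.tensorEntry, Port.append, Port.inr, interp]
        · exact isEmptyElim i
      · funext o
        rcases o with o | o
        · exact isEmptyElim o
        · simp [exitVal, Game.tensorExit, Port.append, Port.inr]

end ParityGame

theorem mainTheorem5 (M : ℕ) (hM : 2 ≤ M) (m n : ℕ)
    (c d : ParityGame.Diagram M (ParityGame.rightWires m) (ParityGame.rightWires n))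
    (hc : c.IsAcyclic) (hd : d.IsAcyclic) (hc' : c.IsNormalForm) (hd' : d.IsNormalForm)
    (h : c.toGame.Equivalent d.toGame) :
    ParityGame.PGAEq c d := by
  open ParityGame in
  refine PGAEq.of_interp hc hd fun T i hi => ?_
  -- A valuation `T` of the outgoing wires is the same as a set of outcomes. No priority has been
  -- seen at the start, hence the interpretation is evaluated at `0`.
  have key (e : Diagram M (rightWires m) (rightWires n)) (he : e.IsAcyclic) :
      ({o | exitVal _ _ T o.1 o.2},
        Sum.inl ⟨⟨i, by simpa using hi⟩, by simp⟩) ∈ e.toGame.semantics ↔ e.interp T i 0 := by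
    obtain ⟨X, hX⟩ := e.exists_isSolution he (allRight_rightWires m) T
    exact hX.mem_semantics (e.isRanked he (allRight_rightWires m)) _
  rw [← key c hc, ← key d hd, show c.toGame.semantics = d.toGame.semantics from h]
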